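/- Let $A$ be a finite set of monadic predicate symbols. The language $\mathrm{FOE}^\infty(A)$ consists of the formulas $\varphi ::= \top \mid \bot \mid a(x) \mid \neg a(x) \mid x\approx y \mid x\not\approx y \mid \varphi\lor\varphi \mid \varphi\land\varphi \mid \exists x.\varphi \mid \forall x.\varphi \mid \exists^\infty x.\varphi \mid \forall^\infty x.\varphi$ with $a\in A$ and $x,y$ from a countably infinite set of individual variables. The fragment $\mathrm{FOE}(A)$ omits $\exists^\infty,\forall^\infty$, and $\mathrm{M}(A)$ omits moreover $\approx,\not\approx$. A model $(D,V)$ is a (possibly empty) set $D$ with a valuation $V:A\to\wp(D)$. Truth is defined as usual, where $\exists^\infty x.\varphi$ means that infinitely many $d\in D$ satisfy $\varphi$ and $\forall^\infty x.\varphi$ that all but at most finitely many do; in the empty model, sentences starting with $\exists$ or $\exists^\infty$ are false and those starting with $\forall$ or $\forall^\infty$ are true. Two sentences are equivalent if they are true in the same models. Let $L\in\{\mathrm{M},\mathrm{FOE},\mathrm{FOE}^\infty\}$ and $B\subseteq A$. A formula $\varphi\in L(A)$ is monotone in $B$ if, for all valuations $V,V'$ on the same domain $D$ with $V(b)\subseteq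 V'(b)$ for $b\in B$ and $V(a)=V'(a)$ for $a\in A\setminus B$, and for every assignment $g$ of elements of $D$ to the variables, $(D,V),g\models\varphi$ implies $(D,V'),g\models\varphi$. The $B$-positive formulas of $L(A)$ are those generated from the formulas $\psi\in L(A\setminus B)$ and the atoms $b(x)$ with $b\in B$ by $\land,\lor,\exists x,\forall x$ and, if $L=\mathrm{FOE}^\infty$, also by $\exists^\infty x,\forall^\infty x$. Theorem. (1) A sentence $\varphi\in L(A)$ is monotone in $B$ if and only if it is equivalent to a $B$-positive sentence of $L(A)$. (2) There is an effective (computable) translation $\varphi\mapsto\varphi^{\oslash}$ that sends each sentence $\varphi\in L(A)$ to a $B$-positive sentence $\varphi^{\oslash}$ of $L(A)$ such that $\varphi$ is monotone in $B$ if and only if $\varphi$ is equivalent to $\varphi^{\oslash}$. (3) It is decidable whether a given sentence $\varphi\in L(A)$ is monotone in $B$. -/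

import Mathlib

universe u v

namespace MonadicLogic

/-- Monadic formulas in negation normal form over a set `A` of predicate symbols, with the
generalised quantifiers `exInf` (there are infinitely many) and `allInf` (for all but at most
finitely many). The individual variables are the natural numbers. -/
inductive Formula (A : Type v) : Type v
  | top : Formula A
  | bot : Formula A
  | pos (a : A) (x : ℕ) : Formula A
  | neg (a : A) (x : ℕ) : Formula A
  | equal (x y : ℕ) : Formula A
  | nequal (x y : ℕ) : Formula A
  | or (φ ψ : Formula A) : Formula A
  | and (φ ψ : Formula A) : Formula A
  | ex (x : ℕ) (φ : Formula A) : Formula A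
  | all (x : ℕ) (φ : Formula A) : Formula A
  | exInf (x : ℕ) (φ : Formula A) : Formula A
  | allInf (x : ℕ) (φ : Formula A) : Formula A

/-- The three monadic logics: first-order logic without equality, first-order logic with
equality, and its extension with the two generalised quantifiers. -/
inductive Logic : Type
  | M
  | FOE
  | FOEinf

namespace Formula

variable {A : Type v}

/-- The set of free variables of a formula. -/
def freeVars : Formula A → Set ℕ
  | top => ∅
  | bot => ∅
  | pos _ x => {x}
  | neg _ x => {x}
  | equal x y => {x, y}
  | nequal x y => {x, y}
  | or φ ψ => φ.freeVars ∪ ψ.freeVars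
  | and φ ψ => φ.freeVars ∪ ψ.freeVars
  | ex x φ => φ.freeVars \ {x}
  | all x φ => φ.freeVars \ {x}
  | exInf x φ => φ.freeVars \ {x}
  | allInf x φ => φ.freeVars \ {x}

/-- A sentence is a formula without free variables. -/
def IsSentence (φ : Formula A) : Prop := φ.freeVars = ∅

/-- The set of predicate symbols that occur in a formula. -/
def names : Formula A → Set A
  | top => ∅
  | bot => ∅
  | pos a _ => {a}
  | neg a _ => {a}
  | equal _ _ => ∅
  | nequal _ _ => ∅
  | or φ ψ => φ.names ∪ ψ.names
  | and φ ψ => φ.names ∪ ψ.names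
  | ex _ φ => φ.names
  | all _ φ => φ.names
  | exInf _ φ => φ.names
  | allInf _ φ => φ.names

/-- `φ.InLogic L`: the formula `φ` belongs to the language `L(A)`. -/
def InLogic (L : Logic) : Formula A → Prop
  | top => True
  | bot => True
  | pos _ _ => True
  | neg _ _ => True
  | equal _ _ => L ≠ Logic.M
  | nequal _ _ => L ≠ Logic.M
  | or φ ψ => φ.InLogic L ∧ ψ.InLogic L
  | and φ ψ => φ.InLogic L ∧ ψ.InLogic L
  | ex _ φ => φ.InLogic L
  | all _ φ => φ.InLogic L
  | exInf _ φ => L = Logic.FOEinf ∧ φ.InLogic L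
  | allInf _ φ => L = Logic.FOEinf ∧ φ.InLogic L

/-- Truth of a formula in a model `(D, V)` under an assignment `g`. -/
def Sat {D : Type u} (V : A → Set D) : (ℕ → D) → Formula A → Prop
  | _, top => True
  | _, bot => False
  | g, pos a x => g x ∈ V a
  | g, neg a x => g x ∉ V a
  | g, equal x y => g x = g y
  | g, nequal x y => g x ≠ g y
  | g, or φ ψ => φ.Sat V g ∨ ψ.Sat V g
  | g, and φ ψ => φ.Sat V g ∧ ψ.Sat V g
  | g, ex x φ => ∃ d : D, φ.Sat V (Function.update g x d)
  | g, all x φ => ∀ d : D, φ.Sat V (Function.update g x d)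
  | g, exInf x φ => {d : D | φ.Sat V (Function.update g x d)}.Infinite
  | g, allInf x φ => {d : D | ¬ φ.Sat V (Function.update g x d)}.Finite

/-- Truth of a sentence in the model with empty domain: existential quantifications are false,
universal ones are true. (The clauses for atoms with variables are irrelevant, since these are not
reached from a sentence.) -/
def EmptySat : Formula A → Prop
  | top => True
  | bot => False
  | pos _ _ => False
  | neg _ _ => False
  | equal _ _ => False
  | nequal _ _ => False
  | or φ ψ => φ.EmptySat ∨ ψ.EmptySat
  | and φ ψ => φ.EmptySat ∧ ψ.EmptySat
  | ex _ _ => False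
  | all _ _ => True
  | exInf _ _ => False
  | allInf _ _ => True

/-- The truth relation between models (possibly with empty domain) and sentences. On a non-empty
domain the truth of a sentence does not depend on the assignment. -/
def TrueIn {D : Type u} (V : A → Set D) (φ : Formula A) : Prop :=
  (IsEmpty D ∧ φ.EmptySat) ∨ (Nonempty D ∧ ∀ g : ℕ → D, φ.Sat V g)

/-- Two sentences are equivalent if they are true in the same models. -/
def Equivalent (φ ψ : Formula A) : Prop :=
  ∀ (D : Type u) (V : A → Set D), φ.TrueIn V ↔ ψ.TrueIn V

end Formula

/-- The valuation `V'` is a `B`-extension of the valuation `V`. -/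
def BExtension {A : Type v} {D : Type u} (B : Set A) (V V' : A → Set D) : Prop :=
  (∀ b ∈ B, V b ⊆ V' b) ∧ ∀ a, a ∉ B → V a = V' a

namespace Formula

variable {A : Type v}

/-- The formula `φ` is monotone in the set `B` of predicate symbols. (There are no assignments
into an empty domain, and only one valuation on it.) -/
def MonotoneIn (B : Set A) (φ : Formula A) : Prop :=
  ∀ (D : Type u) (V V' : A → Set D), BExtension B V V' →
    ∀ g : ℕ → D, φ.Sat V g → φ.Sat V' g

/-- The `B`-positive formulas of the logic `L`. -/
inductive Positive (L : Logic) (B : Set A) : Formula A → Prop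
  | free (ψ : Formula A) : ψ.InLogic L → Disjoint ψ.names B → Positive L B ψ
  | pos (b : A) (x : ℕ) : b ∈ B → Positive L B (pos b x)
  | and (φ ψ : Formula A) : Positive L B φ → Positive L B ψ → Positive L B (and φ ψ)
  | or (φ ψ : Formula A) : Positive L B φ → Positive L B ψ → Positive L B (or φ ψ)
  | ex (x : ℕ) (φ : Formula A) : Positive L B φ → Positive L B (ex x φ)
  | all (x : ℕ) (φ : Formula A) : Positive L B φ → Positive L B (all x φ)
  | exInf (x : ℕ) (φ : Formula A) : L = Logic.FOEinf → Positive L B φ → Positive L B (exInf x φ)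
  | allInf (x : ℕ) (φ : Formula A) : L = Logic.FOEinf → Positive L B φ → Positive L B (allInf x φ)

/-- The Gödel number of a formula. -/
def godelNumber [Encodable A] : Formula A → ℕ
  | top => Nat.pair 0 0
  | bot => Nat.pair 1 0
  | pos a x => Nat.pair 2 (Nat.pair (Encodable.encode a) x)
  | neg a x => Nat.pair 3 (Nat.pair (Encodable.encode a) x)
  | equal x y => Nat.pair 4 (Nat.pair x y)
  | nequal x y => Nat.pair 5 (Nat.pair x y)
  | or φ ψ => Nat.pair 6 (Nat.pair φ.godelNumber ψ.godelNumber)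
  | and φ ψ => Nat.pair 7 (Nat.pair φ.godelNumber ψ.godelNumber)
  | ex x φ => Nat.pair 8 (Nat.pair x φ.godelNumber)
  | all x φ => Nat.pair 9 (Nat.pair x φ.godelNumber)
  | exInf x φ => Nat.pair 10 (Nat.pair x φ.godelNumber)
  | allInf x φ => Nat.pair 11 (Nat.pair x φ.godelNumber)

theorem godelNumber_injective [Encodable A] :
    Function.Injective (godelNumber : Formula A → ℕ) := by
  intro φ
  induction φ with
  | top => intro ψ h; cases ψ <;> simp_all [godelNumber, Nat.pair_eq_pair]
  | bot => intro ψ h; cases ψ <;> simp_all [godelNumber, Nat.pair_eq_pair]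
  | pos a x => intro ψ h; cases ψ <;> simp_all [godelNumber, Nat.pair_eq_pair]
  | neg a x => intro ψ h; cases ψ <;> simp_all [godelNumber, Nat.pair_eq_pair]
  | equal x y => intro ψ h; cases ψ <;> simp_all [godelNumber, Nat.pair_eq_pair]
  | nequal x y => intro ψ h; cases ψ <;> simp_all [godelNumber, Nat.pair_eq_pair]
  | or φ ψ ih₁ ih₂ =>
    intro χ h
    cases χ <;> simp [godelNumber, Nat.pair_eq_pair] at h ⊢
    exact ⟨ih₁ h.1, ih₂ h.2⟩
  | and φ ψ ih₁ ih₂ =>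
    intro χ h
    cases χ <;> simp [godelNumber, Nat.pair_eq_pair] at h ⊢
    exact ⟨ih₁ h.1, ih₂ h.2⟩
  | ex x φ ih =>
    intro χ h
    cases χ <;> simp [godelNumber, Nat.pair_eq_pair] at h ⊢
    exact ⟨h.1, ih h.2⟩
  | all x φ ih =>
    intro χ h
    cases χ <;> simp [godelNumber, Nat.pair_eq_pair] at h ⊢
    exact ⟨h.1, ih h.2⟩
  | exInf x φ ih =>
    intro χ h
    cases χ <;> simp [godelNumber, Nat.pair_eq_pair] at h ⊢
    exact ⟨h.1, ih h.2⟩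
  | allInf x φ ih =>
    intro χ h
    cases χ <;> simp [godelNumber, Nat.pair_eq_pair] at h ⊢
    exact ⟨h.1, ih h.2⟩

end Formula

/-- A map between formulas is effective if it is computed, on Gödel numbers, by a (total)
recursive function. -/
def Effective {A : Type v} [Encodable A] (t : Formula A → Formula A) : Prop :=
  ∃ f : ℕ → ℕ, Computable f ∧ ∀ φ : Formula A, f φ.godelNumber = (t φ).godelNumber

/-- A property of formulas is decidable if the set of Gödel numbers of the formulas that have it
is recursive. -/
def DecidableProperty {A : Type v} [Encodable A] (P : Formula A → Prop) : Prop :=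
  ComputablePred fun k : ℕ => ∃ φ : Formula A, φ.godelNumber = k ∧ P φ

end MonadicLogic

/-! An element of a model matters only through its colour, the set of predicate symbols true at it.
A sentence with variables below `N` sees of a coloured set at most the number of elements of each
colour, truncated at `N`, and, when the quantifiers `exInf` and `allInf` are available, which
classes are infinite (`sat_of_signature_eq`). Without equality it sees only which colours occur
(`sat_iff_of_same_colours`). Both are back-and-forth arguments.

Decidability: such a signature is coded by the digits of one number, and truth in the coded
structure is primitive recursive in the Gödel number (`evalCode_primrec`, `sat_iff_mem_evalCode`). A
valuation together with a `B`-extension of it is a single colouring by pairs of types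
(`monotoneIn_iff`). Monotonicity is therefore an entailment between two readings of the same
formula, and entailment needs checking only on a bounded set of coded structures
(`codeEntails_iff`). Equivalence is handled in the same way.

Normal form: with equality, a monotone sentence is equivalent on non-empty models to a disjunction
over the finitely many signatures of its models. Each disjunct is a `B`-positive sentence saying
that the valuation `B`-extends one with that signature (`exists_signature_sentence`). A model of the
sentence satisfies the disjunct of its own signature; a model of a disjunct `B`-extends a model of
the sentence, so monotonicity applies. In `M` distinct witnesses cannot be demanded, and the model
is first replaced by several copies of itself (`exists_positive_of_no_eq`). The empty model is
corrected separately (`exists_positive`). Conversely, positive formulas are monotone by induction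
(`NegIn.sat_mono`).

Translation: since monotonicity and equivalence are decidable, a positive equivalent of a monotone
sentence is found by unbounded search. A sentence that is not monotone may go to any positive
sentence, because it cannot be equivalent to one. -/

namespace MonadicLogic

/-! ### Bounded primitive recursive operations and recursion on Gödel numbers. -/

section PrimitiveRecursion

variable {α : Type*} [Primcodable α]

theorem _root_.Primrec.nat_pow : Primrec₂ ((· ^ ·) : ℕ → ℕ → ℕ) :=
  Primrec₂.unpaired'.1 Nat.Primrec.pow

theorem _root_.PrimrecPred.const (p : Prop) : PrimrecPred fun _ : α => p := by
  classical exact (Primrec.const (decide p)).primrecPred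

theorem _root_.PrimrecPred.imp {p q : α → Prop} (hp : PrimrecPred p) (hq : PrimrecPred q) :
    PrimrecPred fun a => p a → q a :=
  (hp.not.or hq).of_eq fun _ => imp_iff_not_or.symm

theorem _root_.PrimrecPred.iff {p q : α → Prop} (hp : PrimrecPred p) (hq : PrimrecPred q) :
    PrimrecPred fun a => p a ↔ q a :=
  ((hp.imp hq).and (hq.imp hp)).of_eq fun _ => iff_iff_implies_and_implies.symm

theorem _root_.PrimrecPred.bex_lt {f : α → ℕ} {p : α × ℕ → Prop} (hf : Primrec f)
    (hp : PrimrecPred p) : PrimrecPred fun a => ∃ x < f a, p (a, x) := by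
  have h : PrimrecRel fun (x : ℕ) (a : α) => p (a, x) :=
    hp.comp (Primrec.snd.pair Primrec.fst)
  exact (h.exists_mem_list.comp (Primrec.list_range.comp hf) Primrec.id).of_eq fun a => by simp

theorem _root_.PrimrecPred.ball_lt {f : α → ℕ} {p : α × ℕ → Prop} (hf : Primrec f)
    (hp : PrimrecPred p) : PrimrecPred fun a => ∀ x < f a, p (a, x) := by
  have h : PrimrecRel fun (x : ℕ) (a : α) => p (a, x) :=
    hp.comp (Primrec.snd.pair Primrec.fst)
  exact (h.forall_mem_list.comp (Primrec.list_range.comp hf) Primrec.id).of_eq fun a => by simp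

theorem _root_.PrimrecPred.mem_list {β : Type*} [Primcodable β] {f : α → β} {l : α → List β}
    (hf : Primrec f) (hl : Primrec l) : PrimrecPred fun a => f a ∈ l a := by
  have h : PrimrecRel fun (x : β) (y : β) => x = y := Primrec.eq
  exact (h.exists_mem_list.comp hl hf).of_eq fun a => by simp

theorem _root_.Primrec.filter_range {f : α → ℕ} {p : α × ℕ → Prop} [DecidablePred p]
    (hf : Primrec f) (hp : PrimrecPred p) :
    Primrec fun a => (List.range (f a)).filter fun x => p (a, x) := by
  classical
  have h : PrimrecRel fun (x : ℕ) (a : α) => p (a, x) :=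
    hp.comp (Primrec.snd.pair Primrec.fst)
  exact (h.listFilter.comp (Primrec.list_range.comp hf) Primrec.id).of_eq fun a => by simp

/-- The digit of `s` at position `i` in base `b`. -/
def digit (b s i : ℕ) : ℕ := s / b ^ i % b

theorem digit_primrec {f g h : α → ℕ} (hf : Primrec f) (hg : Primrec g) (hh : Primrec h) :
    Primrec fun a => digit (f a) (g a) (h a) :=
  Primrec.nat_mod.comp (Primrec.nat_div.comp hg (Primrec.nat_pow.comp hf hh)) hf

/-- Both assignments and structures are coded by numbers in a fixed base; this makes quantification
over them a bounded quantification over numbers. -/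
theorem exists_digits {b n : ℕ} (f : ℕ → ℕ) (hf : ∀ i < n, f i < b) :
    ∃ s < b ^ n, ∀ i < n, digit b s i = f i := by
  let F : Fin n → Fin b := fun i => ⟨f i, hf i i.2⟩
  refine ⟨finFunctionFinEquiv F, (finFunctionFinEquiv F).2, fun i hi => ?_⟩
  have := congrArg Fin.val (congrFun (finFunctionFinEquiv.symm_apply_apply F) ⟨i, hi⟩)
  simpa [finFunctionFinEquiv, F, digit] using this

/-- The data that a local condition on Gödel numbers may depend on: a parameter, a Gödel number, a
candidate, and the sets that belong to the two components of the Gödel number. -/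
abbrev StepData (α : Type*) := α × ℕ × ℕ × List ℕ × List ℕ

open Classical in
/-- Recursion on Gödel numbers for finite sets of numbers. -/
noncomputable def codeRec (b : α → ℕ) (step : StepData α → Prop) (a : α) (n : ℕ) : List ℕ :=
  (List.range (b a)).filter fun e =>
    step (a, n, e,
      if _h : n.unpair.2.unpair.1 < n then codeRec b step a n.unpair.2.unpair.1 else [],
      if _h : n.unpair.2.unpair.2 < n then codeRec b step a n.unpair.2.unpair.2 else [])
termination_by n

/-- Course-of-values recursion: `l` lists the values at all smaller numbers, so `l.length` is the
current Gödel number, and the default `[]` of `getD` agrees with the default in `codeRec` when a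
component is not smaller. -/
theorem codeRec_primrec {b : α → ℕ} {step : StepData α → Prop} (hb : Primrec b)
    (hstep : PrimrecPred step) : Primrec₂ (codeRec b step) := by
  classical
  refine Primrec.nat_strong_rec _ (g := fun a l => some ((List.range (b a)).filter fun e =>
    step (a, l.length, e, l.getD l.length.unpair.2.unpair.1 [],
      l.getD l.length.unpair.2.unpair.2 []))) ?_ ?_
  · have hl : Primrec fun x : (α × List (List ℕ)) × ℕ => x.1.2.length :=
      Primrec.list_length.comp (Primrec.snd.comp Primrec.fst)
    have hu : Primrec fun x : (α × List (List ℕ)) × ℕ => x.1.2.length.unpair.2.unpair :=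
      Primrec.unpair.comp (Primrec.snd.comp (Primrec.unpair.comp hl))
    refine Primrec.option_some.comp (Primrec.filter_range (p := fun x : (α × List (List ℕ)) × ℕ =>
      step (x.1.1, x.1.2.length, x.2, x.1.2.getD x.1.2.length.unpair.2.unpair.1 [],
        x.1.2.getD x.1.2.length.unpair.2.unpair.2 [])) (hb.comp Primrec.fst) ?_)
    refine hstep.comp ((Primrec.fst.comp Primrec.fst).pair (hl.pair (Primrec.snd.pair (.pair ?_ ?_))))
    · exact (Primrec.list_getD []).comp (Primrec.snd.comp Primrec.fst) (Primrec.fst.comp hu)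
    · exact (Primrec.list_getD []).comp (Primrec.snd.comp Primrec.fst) (Primrec.snd.comp hu)
  · intro a n
    rw [codeRec]
    simp only [Option.some.injEq, List.length_map, List.length_range]
    congr! 8
    all_goals
      rw [List.getD_eq_getElem?_getD, List.getElem?_map]
      split_ifs with h
      · rw [List.getElem?_range h]; rfl
      · rw [List.getElem?_eq_none (by simpa using h)]; rfl

/-- For a positive tag the components of a code are strictly smaller than the code, so the guards in
`codeRec` hold. Tag `0` is a genuine exception, as `Nat.pair 0 0 = 0`. -/
theorem right_lt_pair {t m : ℕ} (ht : 0 < t) : m < Nat.pair t m := by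
  have := Nat.unpair_add_le (Nat.pair t m)
  simp only [Nat.unpair_pair] at this
  omega

end PrimitiveRecursion

section CodeRecursion

variable {α : Type*} {b : α → ℕ} {step : StepData α → Prop} {a : α} {e : ℕ}

theorem mem_codeRec_pair {t i j : ℕ} (ht : 0 < t) :
    e ∈ codeRec b step a (Nat.pair t (Nat.pair i j)) ↔
      e < b a ∧ step (a, Nat.pair t (Nat.pair i j), e, codeRec b step a i, codeRec b step a j) := by
  have h := right_lt_pair (m := Nat.pair i j) ht
  have hi : i < Nat.pair t (Nat.pair i j) := (Nat.left_le_pair i j).trans_lt h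
  have hj : j < Nat.pair t (Nat.pair i j) := (Nat.right_le_pair i j).trans_lt h
  rw [codeRec]
  simp [hi, hj]

theorem mem_codeRec_zero : e ∈ codeRec b step a 0 ↔ e < b a ∧ step (a, 0, e, [], []) := by
  rw [codeRec]
  simp only [List.mem_filter, List.mem_range]
  refine and_congr_right fun _ => ?_
  classical exact decide_eq_true_iff

/-- Used for tag `0`, where the sets attached to the components are not controlled but the local
condition still holds for some sets. -/
theorem exists_step_of_mem_codeRec {n : ℕ} (h : e ∈ codeRec b step a n) :
    ∃ S S', step (a, n, e, S, S') := by
  rw [codeRec] at h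
  simp only [List.mem_filter, List.mem_range, decide_eq_true_eq] at h
  exact ⟨_, _, h.2⟩

end CodeRecursion

end MonadicLogic

namespace MonadicLogic

/-! ### Evaluation in coded structures -/

/-- The assignments `e` and `e'` agree on the variables below `N` other than `x`. -/
def AgreeOff (N b e e' x : ℕ) : Prop := ∀ y < N, y ≠ x → digit b e' y = digit b e y

/-- The value of `x` differs from the values of the other variables below `N`. -/
def FreshAt (N b e x : ℕ) : Prop := ∀ y < N, y ≠ x → digit b e y ≠ digit b e x

/-- The number `d` is an element of the structure coded by `s`: its colour is `d % T`, and the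
digits of `s` give the numbers of elements of each colour. -/
def InDom (T N s d : ℕ) : Prop := d / T < digit (N + 2) s (d % T)

/-- The colour of `d` represents an infinite class. -/
def Flagged (T N s d : ℕ) : Prop := digit (N + 2) s (d % T) = N + 1

section Primrec

variable {α : Type*} [Primcodable α] {N b e e' x s d : α → ℕ}

theorem agreeOff_primrec (hN : Primrec N) (hb : Primrec b) (he : Primrec e) (he' : Primrec e')
    (hx : Primrec x) : PrimrecPred fun a => AgreeOff (N a) (b a) (e a) (e' a) (x a) := by
  refine PrimrecPred.ball_lt (p := fun y => y.2 ≠ x y.1 →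
    digit (b y.1) (e' y.1) y.2 = digit (b y.1) (e y.1) y.2) hN ?_
  exact (Primrec.eq.comp Primrec.snd (hx.comp Primrec.fst)).not.imp (Primrec.eq.comp
    (digit_primrec (hb.comp Primrec.fst) (he'.comp Primrec.fst) Primrec.snd)
    (digit_primrec (hb.comp Primrec.fst) (he.comp Primrec.fst) Primrec.snd))

theorem freshAt_primrec (hN : Primrec N) (hb : Primrec b) (he : Primrec e) (hx : Primrec x) :
    PrimrecPred fun a => FreshAt (N a) (b a) (e a) (x a) := by
  refine PrimrecPred.ball_lt (p := fun y => y.2 ≠ x y.1 →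
    digit (b y.1) (e y.1) y.2 ≠ digit (b y.1) (e y.1) (x y.1)) hN ?_
  exact (Primrec.eq.comp Primrec.snd (hx.comp Primrec.fst)).not.imp (Primrec.eq.comp
    (digit_primrec (hb.comp Primrec.fst) (he.comp Primrec.fst) Primrec.snd)
    (digit_primrec (hb.comp Primrec.fst) (he.comp Primrec.fst) (hx.comp Primrec.fst))).not

theorem inDom_primrec (T : ℕ) (hN : Primrec N) (hs : Primrec s) (hd : Primrec d) :
    PrimrecPred fun a => InDom T (N a) (s a) (d a) :=
  Primrec.nat_lt.comp (Primrec.nat_div.comp hd (Primrec.const T))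
    (digit_primrec (Primrec.nat_add.comp hN (Primrec.const 2)) hs
      (Primrec.nat_mod.comp hd (Primrec.const T)))

theorem flagged_primrec (T : ℕ) (hN : Primrec N) (hs : Primrec s) (hd : Primrec d) :
    PrimrecPred fun a => Flagged T (N a) (s a) (d a) :=
  Primrec.eq.comp (digit_primrec (Primrec.nat_add.comp hN (Primrec.const 2)) hs
      (Primrec.nat_mod.comp hd (Primrec.const T))) (Primrec.nat_add.comp hN (Primrec.const 1))

end Primrec

/-- The local truth conditions. The list `W` consists of the pairs of (the code of) a predicate
symbol and a colour where the symbol is true. -/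
def evalStep (T : ℕ) (W : List (ℕ × ℕ)) (p : StepData (ℕ × ℕ)) : Prop :=
  let N := p.1.1
  let s := p.1.2
  let b := N * T
  let t := p.2.1.unpair.1
  let i := p.2.1.unpair.2.unpair.1
  let j := p.2.1.unpair.2.unpair.2
  let e := p.2.2.1
  let S := p.2.2.2.1
  let S' := p.2.2.2.2
  t = 0 ∨ t = 2 ∧ (i, digit b e j % T) ∈ W ∨ t = 3 ∧ (i, digit b e j % T) ∉ W ∨
    t = 4 ∧ digit b e i = digit b e j ∨ t = 5 ∧ digit b e i ≠ digit b e j ∨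
    t = 6 ∧ (e ∈ S ∨ e ∈ S') ∨ t = 7 ∧ (e ∈ S ∧ e ∈ S') ∨
    t = 8 ∧ (∃ e' < b ^ N, AgreeOff N b e e' i ∧ InDom T N s (digit b e' i) ∧ e' ∈ S') ∨
    t = 9 ∧ (∀ e' < b ^ N, AgreeOff N b e e' i ∧ InDom T N s (digit b e' i) → e' ∈ S') ∨
    -- All elements of one colour that differ from the values of the other variables behave alike.
    -- Hence infinitely many elements satisfy a formula iff a fresh element of some infinite class
    -- does; the case of `allInf` is dual.
    t = 10 ∧ (∃ e' < b ^ N, AgreeOff N b e e' i ∧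
      (Flagged T N s (digit b e' i) ∧ FreshAt N b e' i) ∧ e' ∈ S') ∨
    t = 11 ∧ (∀ e' < b ^ N, AgreeOff N b e e' i ∧
      (Flagged T N s (digit b e' i) ∧ FreshAt N b e' i) → e' ∈ S')

theorem evalStep_primrec (T : ℕ) (W : List (ℕ × ℕ)) : PrimrecPred (evalStep T W) := by
  have hN : Primrec fun p : StepData (ℕ × ℕ) => p.1.1 := Primrec.fst.comp Primrec.fst
  have hs : Primrec fun p : StepData (ℕ × ℕ) => p.1.2 := Primrec.snd.comp Primrec.fst
  have hn : Primrec fun p : StepData (ℕ × ℕ) => p.2.1 := Primrec.fst.comp Primrec.snd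
  have ht : Primrec fun p : StepData (ℕ × ℕ) => p.2.1.unpair.1 :=
    Primrec.fst.comp (Primrec.unpair.comp hn)
  have hu : Primrec fun p : StepData (ℕ × ℕ) => p.2.1.unpair.2.unpair :=
    Primrec.unpair.comp (Primrec.snd.comp (Primrec.unpair.comp hn))
  have hi := Primrec.fst.comp hu
  have hj := Primrec.snd.comp hu
  have he : Primrec fun p : StepData (ℕ × ℕ) => p.2.2.1 :=
    Primrec.fst.comp (Primrec.snd.comp Primrec.snd)
  have hS : Primrec fun p : StepData (ℕ × ℕ) => p.2.2.2.1 :=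
    Primrec.fst.comp (Primrec.snd.comp (Primrec.snd.comp Primrec.snd))
  have hS' : Primrec fun p : StepData (ℕ × ℕ) => p.2.2.2.2 :=
    Primrec.snd.comp (Primrec.snd.comp (Primrec.snd.comp Primrec.snd))
  have hb : Primrec fun p : StepData (ℕ × ℕ) => p.1.1 * T :=
    Primrec.nat_mul.comp hN (Primrec.const T)
  have hbN := Primrec.nat_pow.comp hb hN
  have tag (k : ℕ) : PrimrecPred fun p : StepData (ℕ × ℕ) => p.2.1.unpair.1 = k :=
    Primrec.eq.comp ht (Primrec.const k)
  have hW := PrimrecPred.mem_list (hi.pair (Primrec.nat_mod.comp (digit_primrec hb he hj)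
    (Primrec.const T))) (Primrec.const W)
  have heq := Primrec.eq.comp (digit_primrec hb he hi) (digit_primrec hb he hj)
  have hl := PrimrecPred.mem_list he hS
  have hr := PrimrecPred.mem_list he hS'
  have f {β : Type} [Primcodable β] {g : StepData (ℕ × ℕ) → β} (hg : Primrec g) :
    Primrec fun q : StepData (ℕ × ℕ) × ℕ => g q.1 := hg.comp Primrec.fst
  have hag := agreeOff_primrec (f hN) (f hb) (f he) Primrec.snd (f hi)
  have hdi := digit_primrec (f hb) Primrec.snd (f hi)
  have hdom := inDom_primrec T (f hN) (f hs) hdi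
  have hfl := (flagged_primrec T (f hN) (f hs) hdi).and
    (freshAt_primrec (f hN) (f hb) Primrec.snd (f hi))
  have hm := PrimrecPred.mem_list Primrec.snd (f hS')
  exact (tag 0).or <| ((tag 2).and hW).or <| ((tag 3).and hW.not).or <| ((tag 4).and heq).or <|
    ((tag 5).and heq.not).or <| ((tag 6).and (hl.or hr)).or <| ((tag 7).and (hl.and hr)).or <|
    ((tag 8).and (PrimrecPred.bex_lt hbN (hag.and (hdom.and hm)))).or <|
    ((tag 9).and (PrimrecPred.ball_lt hbN ((hag.and hdom).imp hm))).or <|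
    ((tag 10).and (PrimrecPred.bex_lt hbN (hag.and (hfl.and hm)))).or
    ((tag 11).and (PrimrecPred.ball_lt hbN ((hag.and hfl).imp hm)))

/-- The set of the assignments that satisfy the formula with Gödel number `n` in the structure
coded by `s`, for formulas with variables below `N`. -/
noncomputable def evalCode (T : ℕ) (W : List (ℕ × ℕ)) : ℕ × ℕ → ℕ → List ℕ :=
  codeRec (fun a => (a.1 * T) ^ a.1) (evalStep T W)

theorem evalCode_primrec (T : ℕ) (W : List (ℕ × ℕ)) : Primrec₂ (evalCode T W) :=
  codeRec_primrec (Primrec.nat_pow.comp (Primrec.nat_mul.comp Primrec.fst (Primrec.const T))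
    Primrec.fst) (evalStep_primrec T W)

section Clauses

open Formula

variable {A : Type v} [Encodable A] {T : ℕ} {W : List (ℕ × ℕ)} {N s e : ℕ}

theorem mem_evalCode_top (he : e < (N * T) ^ N) :
    e ∈ evalCode T W (N, s) (godelNumber (top : Formula A)) := by
  rw [evalCode, godelNumber, show Nat.pair 0 0 = 0 from rfl, mem_codeRec_zero]
  simp [evalStep, he]

theorem not_mem_evalCode_bot : e ∉ evalCode T W (N, s) (godelNumber (bot : Formula A)) := by
  rw [evalCode, godelNumber, show Nat.pair 1 0 = Nat.pair 1 (Nat.pair 0 0) from rfl,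
    mem_codeRec_pair one_pos]
  simp [evalStep]

theorem mem_evalCode_pos (he : e < (N * T) ^ N) {a : A} {x : ℕ} :
    e ∈ evalCode T W (N, s) (godelNumber (pos a x)) ↔
      (Encodable.encode a, digit (N * T) e x % T) ∈ W := by
  rw [evalCode, godelNumber, mem_codeRec_pair (by norm_num)]
  simp [evalStep, he]

theorem mem_evalCode_neg (he : e < (N * T) ^ N) {a : A} {x : ℕ} :
    e ∈ evalCode T W (N, s) (godelNumber (neg a x)) ↔
      (Encodable.encode a, digit (N * T) e x % T) ∉ W := by
  rw [evalCode, godelNumber, mem_codeRec_pair (by norm_num)]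
  simp [evalStep, he]

theorem mem_evalCode_equal (he : e < (N * T) ^ N) {x y : ℕ} :
    e ∈ evalCode T W (N, s) (godelNumber (equal x y : Formula A)) ↔
      digit (N * T) e x = digit (N * T) e y := by
  rw [evalCode, godelNumber, mem_codeRec_pair (by norm_num)]
  simp [evalStep, he]

theorem mem_evalCode_nequal (he : e < (N * T) ^ N) {x y : ℕ} :
    e ∈ evalCode T W (N, s) (godelNumber (nequal x y : Formula A)) ↔
      digit (N * T) e x ≠ digit (N * T) e y := by
  rw [evalCode, godelNumber, mem_codeRec_pair (by norm_num)]
  simp [evalStep, he]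

variable {φ ψ : Formula A} {x : ℕ}

theorem mem_evalCode_or (he : e < (N * T) ^ N) :
    e ∈ evalCode T W (N, s) (φ.or ψ).godelNumber ↔
      e ∈ evalCode T W (N, s) φ.godelNumber ∨ e ∈ evalCode T W (N, s) ψ.godelNumber := by
  rw [evalCode, godelNumber, mem_codeRec_pair (by norm_num)]
  simp [evalStep, he]

theorem mem_evalCode_and (he : e < (N * T) ^ N) :
    e ∈ evalCode T W (N, s) (φ.and ψ).godelNumber ↔
      e ∈ evalCode T W (N, s) φ.godelNumber ∧ e ∈ evalCode T W (N, s) ψ.godelNumber := by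
  rw [evalCode, godelNumber, mem_codeRec_pair (by norm_num)]
  simp [evalStep, he]

theorem mem_evalCode_ex (he : e < (N * T) ^ N) :
    e ∈ evalCode T W (N, s) (φ.ex x).godelNumber ↔
      ∃ e' < (N * T) ^ N, AgreeOff N (N * T) e e' x ∧ InDom T N s (digit (N * T) e' x) ∧
        e' ∈ evalCode T W (N, s) φ.godelNumber := by
  rw [evalCode, godelNumber, mem_codeRec_pair (by norm_num)]
  simp [evalStep, he]

theorem mem_evalCode_all (he : e < (N * T) ^ N) :
    e ∈ evalCode T W (N, s) (φ.all x).godelNumber ↔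
      ∀ e' < (N * T) ^ N, AgreeOff N (N * T) e e' x ∧ InDom T N s (digit (N * T) e' x) →
        e' ∈ evalCode T W (N, s) φ.godelNumber := by
  rw [evalCode, godelNumber, mem_codeRec_pair (by norm_num)]
  simp [evalStep, he]

theorem mem_evalCode_exInf (he : e < (N * T) ^ N) :
    e ∈ evalCode T W (N, s) (φ.exInf x).godelNumber ↔
      ∃ e' < (N * T) ^ N, AgreeOff N (N * T) e e' x ∧
        (Flagged T N s (digit (N * T) e' x) ∧ FreshAt N (N * T) e' x) ∧
        e' ∈ evalCode T W (N, s) φ.godelNumber := by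
  rw [evalCode, godelNumber, mem_codeRec_pair (by norm_num)]
  simp [evalStep, he]

theorem mem_evalCode_allInf (he : e < (N * T) ^ N) :
    e ∈ evalCode T W (N, s) (φ.allInf x).godelNumber ↔
      ∀ e' < (N * T) ^ N, AgreeOff N (N * T) e e' x ∧
        (Flagged T N s (digit (N * T) e' x) ∧ FreshAt N (N * T) e' x) →
        e' ∈ evalCode T W (N, s) φ.godelNumber := by
  rw [evalCode, godelNumber, mem_codeRec_pair (by norm_num)]
  simp [evalStep, he]

end Clauses

end MonadicLogic

namespace MonadicLogic

/-! ### Coded structures and models -/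

namespace Formula

variable {A : Type v}

/-- All variables that occur in the formula, free or bound, are below `N`. -/
def VarsBelow (N : ℕ) : Formula A → Prop
  | top => True
  | bot => True
  | pos _ x => x < N
  | neg _ x => x < N
  | equal x y => x < N ∧ y < N
  | nequal x y => x < N ∧ y < N
  | or φ ψ => φ.VarsBelow N ∧ ψ.VarsBelow N
  | and φ ψ => φ.VarsBelow N ∧ ψ.VarsBelow N
  | ex x φ => x < N ∧ φ.VarsBelow N
  | all x φ => x < N ∧ φ.VarsBelow N
  | exInf x φ => x < N ∧ φ.VarsBelow N
  | allInf x φ => x < N ∧ φ.VarsBelow N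

/-- The pairing function dominates its arguments, so the Gödel number plus one always serves as the
bound `N`. -/
theorem varsBelow_of_godelNumber_lt [Encodable A] {N : ℕ} :
    ∀ {φ : Formula A}, φ.godelNumber < N → φ.VarsBelow N := by
  have key {t i j : ℕ} (h : Nat.pair t (Nat.pair i j) < N) : i < N ∧ j < N :=
    ⟨((Nat.left_le_pair i j).trans (Nat.right_le_pair t _)).trans_lt h,
      ((Nat.right_le_pair i j).trans (Nat.right_le_pair t _)).trans_lt h⟩
  intro φ
  induction φ with
  | top => exact fun _ => trivial
  | bot => exact fun _ => trivial
  | pos a x => exact fun h => (key h).2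
  | neg a x => exact fun h => (key h).2
  | equal x y => exact fun h => key h
  | nequal x y => exact fun h => key h
  | or φ ψ ih₁ ih₂ => exact fun h => ⟨ih₁ (key h).1, ih₂ (key h).2⟩
  | and φ ψ ih₁ ih₂ => exact fun h => ⟨ih₁ (key h).1, ih₂ (key h).2⟩
  | ex x φ ih => exact fun h => ⟨(key h).1, ih (key h).2⟩
  | all x φ ih => exact fun h => ⟨(key h).1, ih (key h).2⟩
  | exInf x φ ih => exact fun h => ⟨(key h).1, ih (key h).2⟩
  | allInf x φ ih => exact fun h => ⟨(key h).1, ih (key h).2⟩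

end Formula

/-- If two sets have the same number of elements up to `N`, then an element outside a partial
matching of fewer than `N` indices has a counterpart. -/
theorem exists_fresh_counterpart {D E : Type*} {X : Set D} {Y : Set E} {N : ℕ}
    (hXY : min X.encard N = min Y.encard N) {J : Finset ℕ} (hJ : J.card < N) {g : ℕ → D}
    {h : ℕ → E} (hgh : ∀ x ∈ J, ∀ y ∈ J, g x = g y ↔ h x = h y)
    (hmem : ∀ x ∈ J, g x ∈ X ↔ h x ∈ Y) {d : D} (hd : d ∈ X) (hdJ : ∀ x ∈ J, g x ≠ d) :
    ∃ d' ∈ Y, ∀ x ∈ J, h x ≠ d' := by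
  classical
  by_contra! hcon
  -- Counting: if the values of `h` covered `Y`, then `Y` would have at most as many elements as `g`
  -- takes values in `X`. But `X` also contains `d`, and the number of these values is below `N`, so
  -- the truncation at `N` cannot hide the difference.
  let K := J.filter fun x => g x ∈ X
  have hKJ : ∀ x ∈ K, x ∈ J := fun x hx => (Finset.mem_filter.1 hx).1
  have hYK : Y ⊆ ((K.image h : Finset E) : Set E) := by
    intro d' hd'
    obtain ⟨x, hx, rfl⟩ := hcon d' hd'
    have : x ∈ K := Finset.mem_filter.2 ⟨hx, (hmem x hx).2 hd'⟩
    simpa using ⟨x, this, rfl⟩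
  have hcard : (K.image h).card ≤ (K.image g).card := by
    refine Finset.card_le_card_of_surjOn (fun d => h (Function.invFunOn g K d)) ?_
    intro d' hd'
    obtain ⟨x, hx, rfl⟩ := Finset.mem_image.1 (Finset.mem_coe.1 hd')
    have hex : ∃ y ∈ (K : Set ℕ), g y = g x := ⟨x, hx, rfl⟩
    exact ⟨g x, by simpa using ⟨x, hx, rfl⟩, (hgh _ (hKJ _ (Function.invFunOn_mem hex)) _
      (hKJ _ hx)).1 (Function.invFunOn_eq hex)⟩
  have hXK : ((insert d (K.image g) : Finset D) : Set D) ⊆ X := by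
    intro x hx
    rcases Finset.mem_insert.1 (Finset.mem_coe.1 hx) with rfl | hx
    · exact hd
    · obtain ⟨y, hy, rfl⟩ := Finset.mem_image.1 hx
      exact (Finset.mem_filter.1 hy).2
  have hdK : d ∉ K.image g := by
    intro hx
    obtain ⟨y, hy, hyd⟩ := Finset.mem_image.1 hx
    exact hdJ y (hKJ y hy) hyd
  have h1 : ((K.image g).card + 1 : ℕ) ≤ X.encard := by
    rw [← Finset.card_insert_of_notMem hdK, ← Set.encard_coe_eq_coe_finsetCard]
    exact Set.encard_le_encard hXK
  have h2 : Y.encard ≤ (K.image h).card := by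
    rw [← Set.encard_coe_eq_coe_finsetCard]
    exact Set.encard_le_encard hYK
  have h3 : (K.image g).card < N :=
    (Finset.card_image_le.trans (Finset.card_le_card (Finset.filter_subset _ _))).trans_lt hJ
  have h4 : ((K.image g).card + 1 : ℕ) ≤ min X.encard N := le_min h1 (by exact_mod_cast h3)
  have h5 : min X.encard N ≤ (K.image g).card :=
    hXY ▸ (min_le_left _ _).trans (h2.trans (by exact_mod_cast hcard))
  have h6 : ((K.image g).card + 1 : ℕ) ≤ (K.image g).card := by exact_mod_cast h4.trans h5
  omega

/-! ### Back-and-forth between models and coded structures. -/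

section Matching

variable {D : Type*} {T N s : ℕ} {κ : D → ℕ}

/-- The coded structure `s` has the same numbers of elements of every colour as the coloured set
`D`, up to `N` and, for the logic with generalised quantifiers, up to finiteness. -/
def SigMatch (L : Logic) (T N s : ℕ) (κ : D → ℕ) : Prop :=
  ∀ c < T, min (κ ⁻¹' {c}).encard N = min (digit (N + 2) s c : ℕ∞) N ∧
    (L = Logic.FOEinf → (digit (N + 2) s c = N + 1 ↔ (κ ⁻¹' {c}).Infinite))

/-- The assignments `g` into `D` and `e` into the structure coded by `s` have the same type. -/
def Matches (T N s : ℕ) (κ : D → ℕ) (g : ℕ → D) (e : ℕ) : Prop :=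
  ∀ x < N, InDom T N s (digit (N * T) e x) ∧ digit (N * T) e x % T = κ (g x) ∧
    ∀ y < N, (digit (N * T) e x = digit (N * T) e y ↔ g x = g y)

/-- The elements of colour `c` of the structure coded by `s`. -/
def colourClass (T N s c : ℕ) : Set ℕ := {d | d < N * T ∧ InDom T N s d ∧ d % T = c}

/-- The elements of colour `c` are the numbers `i * T + c` with index `i` below the digit; the bound
`d < N * T` cuts the indices off at `N`. -/
theorem encard_colourClass {c : ℕ} (hc : c < T) :
    (colourClass T N s c).encard = min (digit (N + 2) s c : ℕ∞) N := by
  have hT : 0 < T := by omega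
  have : colourClass T N s c =
      (fun i => i * T + c) '' ((Finset.range (min (digit (N + 2) s c) N) : Finset ℕ) : Set ℕ) := by
    ext d
    simp only [colourClass, InDom, Set.mem_ofPred_eq, Set.mem_image, Finset.coe_range, Set.mem_Iio,
      lt_min_iff]
    constructor
    · rintro ⟨h1, h2, rfl⟩
      exact ⟨d / T, ⟨h2, Nat.div_lt_of_lt_mul (by rwa [mul_comm])⟩, Nat.div_add_mod' d T⟩
    · rintro ⟨i, ⟨h1, h2⟩, rfl⟩
      have hm : (i * T + c) % T = c := by
        rw [add_comm, Nat.add_mul_mod_self_right, Nat.mod_eq_of_lt hc]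
      have hd : (i * T + c) / T = i := by
        rw [add_comm, Nat.add_mul_div_right _ _ hT, Nat.div_eq_of_lt hc, zero_add]
      refine ⟨?_, ?_, hm⟩
      · calc i * T + c < (i + 1) * T := by rw [add_mul]; omega
          _ ≤ N * T := Nat.mul_le_mul_right T h2
      · rwa [hm, hd]
  rw [this, Set.InjOn.encard_image, Set.encard_coe_eq_coe_finsetCard, Finset.card_range]
  · exact Nat.mono_cast.map_min
  · intro i _ j _ hij
    exact Nat.eq_of_mul_eq_mul_right hT (by simpa using hij)

theorem digit_lt {b : ℕ} (hb : 0 < b) (e x : ℕ) : digit b e x < b := Nat.mod_lt _ hb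

variable {g : ℕ → D} {e e' x : ℕ}

/-- One round of the back-and-forth: only the colour of the new value and its equalities with the
other variables have to be compared. -/
theorem Matches.move (h : Matches T N s κ g e) (hag : AgreeOff N (N * T) e e' x)
    {d : D} (hdom : InDom T N s (digit (N * T) e' x)) (hcol : digit (N * T) e' x % T = κ d)
    (heq : ∀ y < N, y ≠ x → (digit (N * T) e y = digit (N * T) e' x ↔ g y = d)) :
    Matches T N s κ (Function.update g x d) e' := by
  intro y hy
  by_cases hyx : y = x
  · subst hyx
    refine ⟨hdom, by simpa using hcol, fun z hz => ?_⟩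
    by_cases hzx : z = y
    · simp [hzx]
    · rw [hag z hz hzx, Function.update_self, Function.update_of_ne hzx, eq_comm, heq z hz hzx,
        eq_comm]
  · rw [hag y hy hyx, Function.update_of_ne hyx]
    refine ⟨(h y hy).1, (h y hy).2.1, fun z hz => ?_⟩
    by_cases hzx : z = x
    · rw [hzx, Function.update_self, heq y hy hyx]
    · rw [hag z hz hzx, Function.update_of_ne hzx, (h y hy).2.2 z hz]

theorem Matches.mem_colourClass (hT : 0 < T) (h : Matches T N s κ g e) {y : ℕ} (hy : y < N) (c : ℕ) :
    g y ∈ κ ⁻¹' {c} ↔ digit (N * T) e y ∈ colourClass T N s c := by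
  simp only [Set.mem_preimage, Set.mem_singleton_iff, colourClass, Set.mem_ofPred_eq,
    (h y hy).1, (h y hy).2.1, digit_lt (Nat.mul_pos (by omega : 0 < N) hT), true_and]

theorem card_erase_range_lt (hx : x < N) : ((Finset.range N).erase x).card < N := by
  rw [Finset.card_erase_of_mem (Finset.mem_range.2 hx), Finset.card_range]
  omega

/-- The step from the model to the code. A value already held by another variable is copied;
otherwise at most `N - 1` other variables are in play, so counting in the colour class yields a
fresh counterpart. -/
theorem Matches.exists_code {L : Logic} (hκ : ∀ d, κ d < T) (hs : SigMatch L T N s κ)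
    (h : Matches T N s κ g e) (hx : x < N) (d : D) :
    ∃ e' < (N * T) ^ N, AgreeOff N (N * T) e e' x ∧ InDom T N s (digit (N * T) e' x) ∧
      Matches T N s κ (Function.update g x d) e' := by
  have hT : 0 < T := (Nat.zero_le _).trans_lt (hκ d)
  have hM : 0 < N * T := Nat.mul_pos (by omega) hT
  obtain ⟨d', hd', hcol, heq⟩ : ∃ d' < N * T, (InDom T N s d' ∧ d' % T = κ d) ∧
      ∀ y < N, y ≠ x → (digit (N * T) e y = d' ↔ g y = d) := by
    by_cases hex : ∃ y < N, y ≠ x ∧ g y = d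
    · obtain ⟨y, hy, -, rfl⟩ := hex
      exact ⟨_, digit_lt hM e y, ⟨(h y hy).1, (h y hy).2.1⟩, fun z hz _ => (h z hz).2.2 y hy⟩
    · push Not at hex
      obtain ⟨d', ⟨h1, h2⟩, h3⟩ := exists_fresh_counterpart (X := κ ⁻¹' {κ d})
        (Y := colourClass T N s (κ d)) (N := N) (J := (Finset.range N).erase x) (g := g)
        (h := digit (N * T) e) (d := d)
        (by rw [encard_colourClass (hκ d), (hs _ (hκ d)).1, min_assoc, min_self])
        (card_erase_range_lt hx)
        (fun y hy z hz => ((h y (by simp_all)).2.2 z (by simp_all)).symm)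
        (fun y hy => h.mem_colourClass hT (by simp_all) _) rfl
        (fun y hy => hex y (by simp_all) (by simp_all))
      exact ⟨d', h1, h2, fun y hy hyx =>
        iff_of_false (h3 y (by simp [hy, hyx])) (hex y hy hyx)⟩
  obtain ⟨e', he', hdig⟩ := exists_digits (b := N * T) (n := N)
    (Function.update (digit (N * T) e) x d') (fun i _ => by
      by_cases hi : i = x
      · simpa [hi] using hd'
      · simpa [hi] using digit_lt hM e i)
  have hag : AgreeOff N (N * T) e e' x := fun y hy hyx => by
    rw [hdig y hy, Function.update_of_ne hyx]
  have hx' : digit (N * T) e' x = d' := by rw [hdig x hx, Function.update_self]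
  rw [← hx'] at hcol heq
  exact ⟨e', he', hag, hcol.1, h.move hag hcol.1 hcol.2 heq⟩

/-- The converse step, from the code to the model, by the same counting. -/
theorem Matches.exists_element {L : Logic} (hT : 0 < T) (hs : SigMatch L T N s κ)
    (h : Matches T N s κ g e) (hx : x < N) (hag : AgreeOff N (N * T) e e' x)
    (hdom : InDom T N s (digit (N * T) e' x)) :
    ∃ d, Matches T N s κ (Function.update g x d) e' := by
  have hM : 0 < N * T := Nat.mul_pos (by omega) hT
  by_cases hex : ∃ y < N, y ≠ x ∧ digit (N * T) e y = digit (N * T) e' x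
  · obtain ⟨y, hy, -, hyx⟩ := hex
    exact ⟨g y, h.move hag hdom (hyx ▸ (h y hy).2.1) fun z hz _ => hyx ▸ (h z hz).2.2 y hy⟩
  · push Not at hex
    have hc := Nat.mod_lt (digit (N * T) e' x) hT
    obtain ⟨d, h1, h2⟩ := exists_fresh_counterpart
      (X := colourClass T N s (digit (N * T) e' x % T)) (Y := κ ⁻¹' {digit (N * T) e' x % T})
      (N := N) (J := (Finset.range N).erase x) (g := digit (N * T) e) (h := g)
      (d := digit (N * T) e' x)
      (by rw [encard_colourClass hc, (hs _ hc).1, min_assoc, min_self])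
      (card_erase_range_lt hx)
      (fun y hy z hz => (h y (by simp_all)).2.2 z (by simp_all))
      (fun y hy => (h.mem_colourClass hT (by simp_all) _).symm)
      ⟨digit_lt hM e' x, hdom, rfl⟩
      (fun y hy => hex y (by simp_all) (by simp_all))
    exact ⟨d, h.move hag hdom h1.symm fun y hy hyx =>
      iff_of_false (hex y hy hyx) (h2 y (by simp [hy, hyx]))⟩

/-- A flagged fresh value corresponds to infinitely many elements. -/
theorem Matches.infinite_elements (hT : 0 < T)
    (hs : SigMatch Logic.FOEinf T N s κ) (h : Matches T N s κ g e)
    (hag : AgreeOff N (N * T) e e' x) (hflag : Flagged T N s (digit (N * T) e' x))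
    (hdom : InDom T N s (digit (N * T) e' x)) (hfresh : FreshAt N (N * T) e' x) :
    {d | Matches T N s κ (Function.update g x d) e'}.Infinite := by
  have hinf := ((hs _ (Nat.mod_lt _ hT)).2 rfl).1 hflag
  refine (hinf.sdiff ((Finset.range N).finite_toSet.image g)).mono ?_
  rintro d ⟨hd, hdg⟩
  refine h.move hag hdom (by simpa using hd.symm) fun y hy hyx => iff_of_false ?_ ?_
  · exact hag y hy hyx ▸ hfresh y hy hyx
  · rintro rfl
    exact hdg ⟨y, by simpa using hy, rfl⟩

/-- In an infinite set there is an element that corresponds to a flagged fresh value. -/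
theorem Matches.exists_flagged (hκ : ∀ d, κ d < T)
    (hs : SigMatch Logic.FOEinf T N s κ) (h : Matches T N s κ g e) (hx : x < N) {S : Set D}
    (hS : S.Infinite) :
    ∃ d ∈ S, ∃ e' < (N * T) ^ N, AgreeOff N (N * T) e e' x ∧
      (Flagged T N s (digit (N * T) e' x) ∧ FreshAt N (N * T) e' x) ∧
      Matches T N s κ (Function.update g x d) e' := by
  -- Pigeonhole: there are finitely many colours, so one of them has infinitely many elements in
  -- `S`. Removing the finitely many values of `g` below `N` then leaves a fresh one.
  obtain ⟨c, hc, hcS⟩ : ∃ c < T, (S ∩ κ ⁻¹' {c}).Infinite := by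
    by_contra! hcon
    refine hS (((Finset.range T).finite_toSet.biUnion fun c hc =>
      hcon c (by simpa using hc)).subset ?_)
    intro d hd
    simpa using ⟨hd, hκ d⟩
  obtain ⟨d, ⟨hdS, hdc⟩, hdg⟩ :=
    (hcS.sdiff ((Finset.range N).finite_toSet.image g)).nonempty
  obtain ⟨e', he', hag, -, hm⟩ := h.exists_code hκ hs hx d
  have hxd := (hm x hx).2
  rw [Function.update_self] at hxd
  refine ⟨d, hdS, e', he', hag, ⟨?_, fun y hy hyx heq => ?_⟩, hm⟩
  · rw [Flagged, hxd.1, hdc]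
    exact ((hs c hc).2 rfl).2 (hcS.mono Set.inter_subset_right)
  · refine hdg ⟨y, by simpa using hy, ?_⟩
    have := (hxd.2 y hy).1 heq.symm
    rw [Function.update_of_ne hyx] at this
    exact this.symm

theorem inDom_of_flagged {d : ℕ} (hd : d < N * T) (h : Flagged T N s d) : InDom T N s d := by
  rw [InDom, h]
  have : d / T < N := Nat.div_lt_of_lt_mul (by rwa [mul_comm])
  omega

open Formula in
/-- Truth in a model agrees with evaluation in a coded structure with the same signature. -/
theorem sat_iff_mem_evalCode {A : Type v} [Encodable A] {L : Logic} {W : List (ℕ × ℕ)}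
    {V : A → Set D} (hW : ∀ a d, (Encodable.encode a, κ d) ∈ W ↔ d ∈ V a) (hκ : ∀ d, κ d < T)
    (hs : SigMatch L T N s κ) {φ : Formula A} (hL : φ.InLogic L) (hN : φ.VarsBelow N) :
    ∀ {g : ℕ → D} {e : ℕ}, e < (N * T) ^ N → Matches T N s κ g e →
      (φ.Sat V g ↔ e ∈ evalCode T W (N, s) φ.godelNumber) := by
  have hTg (g : ℕ → D) : 0 < T := (Nat.zero_le _).trans_lt (hκ (g 0))
  induction φ with
  | top => exact fun {_ _} he _ => iff_of_true trivial (mem_evalCode_top he)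
  | bot => exact fun {_ _} _ _ => iff_of_false id not_mem_evalCode_bot
  | pos a x => exact fun {_ _} he h => by rw [mem_evalCode_pos he, (h x hN).2.1, hW]; rfl
  | neg a x => exact fun {_ _} he h => by rw [mem_evalCode_neg he, (h x hN).2.1, hW]; rfl
  | equal x y => exact fun {_ _} he h => by rw [mem_evalCode_equal he, (h x hN.1).2.2 y hN.2]; rfl
  | nequal x y =>
    exact fun {_ _} he h => by rw [mem_evalCode_nequal he, Ne, (h x hN.1).2.2 y hN.2]; rfl
  | or φ ψ ih₁ ih₂ =>
    exact fun {_ _} he h => by rw [mem_evalCode_or he, ← ih₁ hL.1 hN.1 he h, ← ih₂ hL.2 hN.2 he h]; rfl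
  | and φ ψ ih₁ ih₂ =>
    exact fun {_ _} he h => by rw [mem_evalCode_and he, ← ih₁ hL.1 hN.1 he h, ← ih₂ hL.2 hN.2 he h]; rfl
  | ex x φ ih =>
    intro g e he h
    rw [mem_evalCode_ex he]
    constructor
    · rintro ⟨d, hd⟩
      obtain ⟨e', he', hag, hdom, hm⟩ := h.exists_code hκ hs hN.1 d
      exact ⟨e', he', hag, hdom, (ih hL hN.2 he' hm).1 hd⟩
    · rintro ⟨e', he', hag, hdom, hmem⟩
      obtain ⟨d, hm⟩ := h.exists_element (hTg g) hs hN.1 hag hdom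
      exact ⟨d, (ih hL hN.2 he' hm).2 hmem⟩
  | all x φ ih =>
    intro g e he h
    rw [mem_evalCode_all he]
    constructor
    · rintro hall e' he' ⟨hag, hdom⟩
      obtain ⟨d, hm⟩ := h.exists_element (hTg g) hs hN.1 hag hdom
      exact (ih hL hN.2 he' hm).1 (hall d)
    · intro hall d
      obtain ⟨e', he', hag, hdom, hm⟩ := h.exists_code hκ hs hN.1 d
      exact (ih hL hN.2 he' hm).2 (hall e' he' ⟨hag, hdom⟩)
  | exInf x φ ih =>
    intro g e he h
    obtain ⟨rfl, hL⟩ := hL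
    have hM : 0 < N * T := Nat.mul_pos (by have := hN.1; omega) (hTg g)
    rw [mem_evalCode_exInf he]
    constructor
    · intro hinf
      obtain ⟨d, hd, e', he', hag, hfl, hm⟩ := h.exists_flagged hκ hs hN.1 hinf
      exact ⟨e', he', hag, hfl, (ih hL hN.2 he' hm).1 hd⟩
    · rintro ⟨e', he', hag, hfl, hmem⟩
      exact (h.infinite_elements (hTg g) hs hag hfl.1
        (inDom_of_flagged (digit_lt hM e' x) hfl.1) hfl.2).mono
        fun d hm => (ih hL hN.2 he' hm).2 hmem
  | allInf x φ ih =>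
    intro g e he h
    obtain ⟨rfl, hL⟩ := hL
    have hM : 0 < N * T := Nat.mul_pos (by have := hN.1; omega) (hTg g)
    rw [mem_evalCode_allInf he]
    constructor
    · rintro hfin e' he' ⟨hag, hfl⟩
      by_contra hmem
      exact (h.infinite_elements (hTg g) hs hag hfl.1
        (inDom_of_flagged (digit_lt hM e' x) hfl.1) hfl.2).mono
        (fun d hm hd => hmem ((ih hL hN.2 he' hm).1 hd)) hfin
    · intro hall
      by_contra hinf
      obtain ⟨d, hd, e', he', hag, hfl, hm⟩ := h.exists_flagged hκ hs hN.1 hinf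
      exact hd ((ih hL hN.2 he' hm).2 (hall e' he' ⟨hag, hfl⟩))

end Matching

end MonadicLogic

namespace MonadicLogic

/-! ### Syntactic properties of Gödel numbers -/

section Projections

theorem tag_primrec {α : Type*} [Primcodable α] :
    Primrec fun p : StepData α => p.2.1.unpair.1 :=
  Primrec.fst.comp (Primrec.unpair.comp (Primrec.fst.comp Primrec.snd))

theorem fstComponent_primrec {α : Type*} [Primcodable α] :
    Primrec fun p : StepData α => p.2.1.unpair.2.unpair.1 :=
  Primrec.fst.comp (Primrec.unpair.comp (Primrec.snd.comp (Primrec.unpair.comp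
    (Primrec.fst.comp Primrec.snd))))

theorem sndComponent_primrec {α : Type*} [Primcodable α] :
    Primrec fun p : StepData α => p.2.1.unpair.2.unpair.2 :=
  Primrec.snd.comp (Primrec.unpair.comp (Primrec.snd.comp (Primrec.unpair.comp
    (Primrec.fst.comp Primrec.snd))))

theorem candidate_primrec {α : Type*} [Primcodable α] :
    Primrec fun p : StepData α => p.2.2.1 :=
  Primrec.fst.comp (Primrec.snd.comp Primrec.snd)

theorem fstSet_primrec {α : Type*} [Primcodable α] :
    Primrec fun p : StepData α => p.2.2.2.1 :=
  Primrec.fst.comp (Primrec.snd.comp (Primrec.snd.comp Primrec.snd))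

theorem sndSet_primrec {α : Type*} [Primcodable α] :
    Primrec fun p : StepData α => p.2.2.2.2 :=
  Primrec.snd.comp (Primrec.snd.comp (Primrec.snd.comp Primrec.snd))

end Projections

namespace Formula

variable {A : Type v}

/-- The predicate symbols that occur negated belong to `Z`. -/
def NegIn (Z : Set A) : Formula A → Prop
  | top => True
  | bot => True
  | pos _ _ => True
  | neg a _ => a ∈ Z
  | equal _ _ => True
  | nequal _ _ => True
  | or φ ψ => φ.NegIn Z ∧ ψ.NegIn Z
  | and φ ψ => φ.NegIn Z ∧ ψ.NegIn Z
  | ex _ φ => φ.NegIn Z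
  | all _ φ => φ.NegIn Z
  | exInf _ φ => φ.NegIn Z
  | allInf _ φ => φ.NegIn Z

theorem negIn_univ (φ : Formula A) : φ.NegIn Set.univ := by
  induction φ <;> simp_all [NegIn]

theorem negIn_compl_of_disjoint {B : Set A} {φ : Formula A} (h : Disjoint φ.names B) :
    φ.NegIn Bᶜ := by
  induction φ <;> simp_all [NegIn, names]

theorem Positive.inLogic {L : Logic} {B : Set A} {φ : Formula A} (h : φ.Positive L B) :
    φ.InLogic L := by
  induction h <;> simp_all [InLogic]

theorem Positive.negIn {L : Logic} {B : Set A} {φ : Formula A} (h : φ.Positive L B) :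
    φ.NegIn Bᶜ := by
  induction h with
  | free ψ _ h => exact negIn_compl_of_disjoint h
  | _ => simp_all [NegIn]

theorem positive_of_negIn {L : Logic} {B : Set A} {φ : Formula A} (hL : φ.InLogic L)
    (h : φ.NegIn Bᶜ) : φ.Positive L B := by
  induction φ with
  | top => exact .free _ hL (by simp [names])
  | bot => exact .free _ hL (by simp [names])
  | pos a x =>
    by_cases ha : a ∈ B
    · exact .pos a x ha
    · exact .free _ hL (by simpa [names] using ha)
  | neg a x => exact .free _ hL (by simpa [names, NegIn] using h)
  | equal x y => exact .free _ hL (by simp [names])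
  | nequal x y => exact .free _ hL (by simp [names])
  | or φ ψ ih₁ ih₂ => exact .or _ _ (ih₁ hL.1 h.1) (ih₂ hL.2 h.2)
  | and φ ψ ih₁ ih₂ => exact .and _ _ (ih₁ hL.1 h.1) (ih₂ hL.2 h.2)
  | ex x φ ih => exact .ex _ _ (ih hL h)
  | all x φ ih => exact .all _ _ (ih hL h)
  | exInf x φ ih => exact .exInf _ _ hL.1 (ih hL.2 h)
  | allInf x φ ih => exact .allInf _ _ hL.1 (ih hL.2 h)

/-- Turns positivity into a local condition on subformulas, which recursion on Gödel numbers can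
test. -/
theorem positive_iff {L : Logic} {B : Set A} {φ : Formula A} :
    φ.Positive L B ↔ φ.InLogic L ∧ φ.NegIn Bᶜ :=
  ⟨fun h => ⟨h.inLogic, h.negIn⟩, fun h => positive_of_negIn h.1 h.2⟩

/-- The easy half of the characterisation: every connective and quantifier of the language is
monotone, so only the negated atoms matter, and their symbols keep their values. -/
theorem NegIn.sat_mono {D : Type u} {B : Set A} {φ : Formula A} (h : φ.NegIn Bᶜ)
    {V V' : A → Set D} (hV : BExtension B V V') : ∀ {g : ℕ → D}, φ.Sat V g → φ.Sat V' g := by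
  induction φ with
  | top => exact fun h => h
  | bot => exact fun h => h
  | pos a x =>
    intro g hg
    by_cases ha : a ∈ B
    · exact hV.1 a ha hg
    · exact (hV.2 a ha ▸ hg : g x ∈ V' a)
  | neg a x => exact fun {g} hg => (hV.2 a h ▸ hg : g x ∉ V' a)
  | equal x y => exact fun h => h
  | nequal x y => exact fun h => h
  | or φ ψ ih₁ ih₂ => exact fun hg => hg.imp (ih₁ h.1) (ih₂ h.2)
  | and φ ψ ih₁ ih₂ => exact fun hg => hg.imp (ih₁ h.1) (ih₂ h.2)
  | ex x φ ih => exact fun ⟨d, hd⟩ => ⟨d, ih h hd⟩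
  | all x φ ih => exact fun hg d => ih h (hg d)
  | exInf x φ ih => exact fun hg => hg.mono fun d => ih h
  | allInf x φ ih => exact fun hg => hg.subset fun d hd hd' => hd (ih h hd')

/-- Truth depends only on the values of the free variables. -/
theorem sat_congr {D : Type u} {V : A → Set D} {φ : Formula A} :
    ∀ {g g' : ℕ → D}, (∀ x ∈ φ.freeVars, g x = g' x) → (φ.Sat V g ↔ φ.Sat V g') := by
  have upd {φ : Formula A} {x : ℕ} {g g' : ℕ → D} (h : ∀ y ∈ φ.freeVars \ {x}, g y = g' y) (d : D) :
      ∀ y ∈ φ.freeVars, Function.update g x d y = Function.update g' x d y := by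
    intro y hy
    by_cases hyx : y = x
    · simp [hyx]
    · simpa [hyx] using h y ⟨hy, hyx⟩
  induction φ with
  | top => exact fun _ => Iff.rfl
  | bot => exact fun _ => Iff.rfl
  | pos a x => exact fun h => by rw [Sat, Sat, h x rfl]
  | neg a x => exact fun h => by rw [Sat, Sat, h x rfl]
  | equal x y => exact fun h => by rw [Sat, Sat, h x (Or.inl rfl), h y (Or.inr rfl)]
  | nequal x y => exact fun h => by rw [Sat, Sat, h x (Or.inl rfl), h y (Or.inr rfl)]
  | or φ ψ ih₁ ih₂ =>
    exact fun h => or_congr (ih₁ fun x hx => h x (Or.inl hx)) (ih₂ fun x hx => h x (Or.inr hx))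
  | and φ ψ ih₁ ih₂ =>
    exact fun h => and_congr (ih₁ fun x hx => h x (Or.inl hx)) (ih₂ fun x hx => h x (Or.inr hx))
  | ex x φ ih => exact fun h => exists_congr fun d => ih (upd h d)
  | all x φ ih => exact fun h => forall_congr' fun d => ih (upd h d)
  | exInf x φ ih =>
    exact fun h => by rw [Sat, Sat, Set.ext fun d => ih (upd h d)]
  | allInf x φ ih =>
    exact fun h => by rw [Sat, Sat, Set.ext fun d => not_congr (ih (upd h d))]

theorem IsSentence.sat_congr {D : Type u} {V : A → Set D} {φ : Formula A} (h : φ.IsSentence)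
    (g g' : ℕ → D) : φ.Sat V g ↔ φ.Sat V g' :=
  Formula.sat_congr fun x hx => by rw [IsSentence] at h; simp [h] at hx

theorem VarsBelow.freeVars {N : ℕ} {φ : Formula A} (h : φ.VarsBelow N) :
    ∀ x ∈ φ.freeVars, x < N := by
  induction φ <;> simp_all [VarsBelow, Formula.freeVars] <;> grind

end Formula

open Formula

section Codes

/-- The local conditions for Gödel numbers of formulas of a language. The lists `l` and `l'` consist
of the codes of the predicate symbols that may occur, respectively occur negated. -/
def wellFormedStep (L : Logic) (l l' : List ℕ) (p : StepData ℕ) : Prop :=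
  let t := p.2.1.unpair.1
  let i := p.2.1.unpair.2.unpair.1
  -- For `top` and `bot` the whole number is compared; testing the tag alone would accept numbers
  -- that code no formula.
  p.2.1 = 0 ∨ p.2.1 = Nat.pair 1 0 ∨ t = 2 ∧ i ∈ l ∨ t = 3 ∧ i ∈ l' ∨
    (t = 4 ∨ t = 5) ∧ L ≠ Logic.M ∨ (t = 6 ∨ t = 7) ∧ 0 ∈ p.2.2.2.1 ∧ 0 ∈ p.2.2.2.2 ∨
    (t = 8 ∨ t = 9) ∧ 0 ∈ p.2.2.2.2 ∨ (t = 10 ∨ t = 11) ∧ L = Logic.FOEinf ∧ 0 ∈ p.2.2.2.2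

theorem wellFormedStep_primrec (L : Logic) (l l' : List ℕ) :
    PrimrecPred (wellFormedStep L l l') := by
  have tag (k : ℕ) : PrimrecPred fun p : StepData ℕ => p.2.1.unpair.1 = k :=
    Primrec.eq.comp tag_primrec (Primrec.const k)
  have hn (k : ℕ) : PrimrecPred fun p : StepData ℕ => p.2.1 = k :=
    Primrec.eq.comp (Primrec.fst.comp Primrec.snd) (Primrec.const k)
  have hl (l : List ℕ) := PrimrecPred.mem_list (fstComponent_primrec (α := ℕ)) (Primrec.const l)
  have h1 := PrimrecPred.mem_list (Primrec.const 0) (fstSet_primrec (α := ℕ))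
  have h2 := PrimrecPred.mem_list (Primrec.const 0) (sndSet_primrec (α := ℕ))
  exact (hn _).or <| (hn _).or <| ((tag 2).and (hl l)).or <| ((tag 3).and (hl l')).or <|
    (((tag 4).or (tag 5)).and (.const _)).or <| (((tag 6).or (tag 7)).and (h1.and h2)).or <|
    (((tag 8).or (tag 9)).and h2).or (((tag 10).or (tag 11)).and ((PrimrecPred.const _).and h2))

/-- The set `{0}` or `∅`, depending on whether the number belongs to a formula of the language. -/
noncomputable def wellFormedCode (L : Logic) (l l' : List ℕ) : ℕ → ℕ → List ℕ :=
  codeRec (fun _ => 1) (wellFormedStep L l l')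

theorem wellFormedCode_primrec (L : Logic) (l l' : List ℕ) :
    PrimrecPred fun n => 0 ∈ wellFormedCode L l l' 0 n :=
  PrimrecPred.mem_list (Primrec.const 0) ((codeRec_primrec (Primrec.const 1)
    (wellFormedStep_primrec L l l')).comp (Primrec.const 0) Primrec.id)

variable {A : Type v} [Encodable A]

/-- With `Z = Set.univ` this recognises the formulas of `L`, with `Z = Bᶜ` the `B`-positive ones. -/
theorem zero_mem_wellFormedCode {L : Logic} {l l' : List ℕ} {Z : Set A}
    (hl : ∀ i, i ∈ l ↔ ∃ a : A, Encodable.encode a = i)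
    (hl' : ∀ i, i ∈ l' ↔ ∃ a ∈ Z, Encodable.encode a = i) (n : ℕ) :
    0 ∈ wellFormedCode L l l' 0 n ↔ ∃ φ : Formula A, φ.godelNumber = n ∧ φ.InLogic L ∧ φ.NegIn Z := by
  constructor
  · induction n using Nat.strong_induction_on with
    | _ n ih =>
    intro h
    obtain ⟨t, i, j, rfl⟩ : ∃ t i j, n = Nat.pair t (Nat.pair i j) :=
      ⟨_, _, _, by rw [Nat.pair_unpair, Nat.pair_unpair]⟩
    rcases Nat.eq_zero_or_pos t with rfl | ht
    · obtain ⟨S, S', h⟩ := exists_step_of_mem_codeRec h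
      simp only [wellFormedStep, Nat.unpair_pair, Nat.pair_eq_pair] at h
      norm_num at h
      exact ⟨top, by rw [h]; rfl, trivial, trivial⟩
    · have hlt := right_lt_pair (m := Nat.pair i j) ht
      have ihi := ih i ((Nat.left_le_pair i j).trans_lt hlt)
      have ihj := ih j ((Nat.right_le_pair i j).trans_lt hlt)
      rw [wellFormedCode, mem_codeRec_pair ht, ← wellFormedCode] at h
      simp only [wellFormedStep, Nat.unpair_pair] at h
      replace h := h.2
      rcases h with h | h | ⟨rfl, h⟩ | ⟨rfl, h⟩ | ⟨rfl | rfl, h⟩ | ⟨rfl | rfl, h1, h2⟩ |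
        ⟨rfl | rfl, h⟩ | ⟨rfl | rfl, h1, h⟩
      · exact ⟨top, h.symm, trivial, trivial⟩
      · exact ⟨bot, h.symm, trivial, trivial⟩
      · obtain ⟨a, rfl⟩ := (hl i).1 h
        exact ⟨pos a j, rfl, trivial, trivial⟩
      · obtain ⟨a, ha, rfl⟩ := (hl' i).1 h
        exact ⟨neg a j, rfl, trivial, ha⟩
      · exact ⟨equal i j, rfl, h, trivial⟩
      · exact ⟨nequal i j, rfl, h, trivial⟩
      · obtain ⟨φ, rfl, h1, h1'⟩ := ihi h1
        obtain ⟨ψ, rfl, h2, h2'⟩ := ihj h2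
        exact ⟨φ.or ψ, rfl, ⟨h1, h2⟩, h1', h2'⟩
      · obtain ⟨φ, rfl, h1, h1'⟩ := ihi h1
        obtain ⟨ψ, rfl, h2, h2'⟩ := ihj h2
        exact ⟨φ.and ψ, rfl, ⟨h1, h2⟩, h1', h2'⟩
      · obtain ⟨φ, rfl, h2, h2'⟩ := ihj h
        exact ⟨φ.ex i, rfl, h2, h2'⟩
      · obtain ⟨φ, rfl, h2, h2'⟩ := ihj h
        exact ⟨φ.all i, rfl, h2, h2'⟩
      · obtain ⟨φ, rfl, h2, h2'⟩ := ihj h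
        exact ⟨φ.exInf i, rfl, ⟨h1, h2⟩, h2'⟩
      · obtain ⟨φ, rfl, h2, h2'⟩ := ihj h
        exact ⟨φ.allInf i, rfl, ⟨h1, h2⟩, h2'⟩
  · rintro ⟨φ, rfl, hL, hZ⟩
    induction φ with
    | top =>
      rw [godelNumber, show Nat.pair 0 0 = 0 from rfl, wellFormedCode, mem_codeRec_zero]
      simp [wellFormedStep]
    | bot =>
      rw [godelNumber, show Nat.pair 1 0 = Nat.pair 1 (Nat.pair 0 0) from rfl, wellFormedCode,
        mem_codeRec_pair one_pos]
      exact ⟨one_pos, Or.inr (Or.inl rfl)⟩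
    | exInf x φ ih | allInf x φ ih =>
      rw [godelNumber, wellFormedCode, mem_codeRec_pair (by norm_num), ← wellFormedCode]
      have := ih hL.2 hZ
      simp_all [wellFormedStep, InLogic]
    | _ =>
      rw [godelNumber, wellFormedCode, mem_codeRec_pair (by norm_num), ← wellFormedCode]
      simp_all [wellFormedStep, InLogic, NegIn]

/-- The local conditions for free variables. -/
def freeStep (p : StepData ℕ) : Prop :=
  let t := p.2.1.unpair.1
  let i := p.2.1.unpair.2.unpair.1
  let j := p.2.1.unpair.2.unpair.2
  let e := p.2.2.1
  (t = 2 ∨ t = 3) ∧ e = j ∨ (t = 4 ∨ t = 5) ∧ (e = i ∨ e = j) ∨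
    (t = 6 ∨ t = 7) ∧ (e ∈ p.2.2.2.1 ∨ e ∈ p.2.2.2.2) ∨ 8 ≤ t ∧ e ∈ p.2.2.2.2 ∧ e ≠ i

theorem freeStep_primrec : PrimrecPred freeStep := by
  have tag (k : ℕ) : PrimrecPred fun p : StepData ℕ => p.2.1.unpair.1 = k :=
    Primrec.eq.comp tag_primrec (Primrec.const k)
  have hi := Primrec.eq.comp candidate_primrec (fstComponent_primrec (α := ℕ))
  have hj := Primrec.eq.comp candidate_primrec (sndComponent_primrec (α := ℕ))
  have h1 := PrimrecPred.mem_list candidate_primrec (fstSet_primrec (α := ℕ))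
  have h2 := PrimrecPred.mem_list candidate_primrec (sndSet_primrec (α := ℕ))
  exact (((tag 2).or (tag 3)).and hj).or <| (((tag 4).or (tag 5)).and (hi.or hj)).or <|
    (((tag 6).or (tag 7)).and (h1.or h2)).or
    ((Primrec.nat_le.comp (Primrec.const 8) tag_primrec).and (h2.and hi.not))

/-- The free variables below `N` of the formula with a given Gödel number. -/
noncomputable def freeCode : ℕ → ℕ → List ℕ := codeRec id freeStep

theorem mem_freeCode {N e : ℕ} {φ : Formula A} :
    e ∈ freeCode N φ.godelNumber ↔ e < N ∧ e ∈ φ.freeVars := by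
  induction φ with
  | top =>
    rw [godelNumber, show Nat.pair 0 0 = 0 from rfl, freeCode, mem_codeRec_zero]
    simp [freeStep, freeVars]
  | bot =>
    rw [godelNumber, show Nat.pair 1 0 = Nat.pair 1 (Nat.pair 0 0) from rfl, freeCode,
      mem_codeRec_pair one_pos]
    simp [freeStep, freeVars]
  | _ =>
    rw [godelNumber, freeCode, mem_codeRec_pair (by norm_num), ← freeCode]
    simp [freeStep, freeVars, *]
    try tauto

/-- A bounded search suffices, since every variable of a formula is below its Gödel number plus one.
-/
theorem isSentence_iff {φ : Formula A} :
    φ.IsSentence ↔ ∀ e < φ.godelNumber + 1, e ∉ freeCode (φ.godelNumber + 1) φ.godelNumber := by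
  simp only [mem_freeCode, not_and, IsSentence, Set.eq_empty_iff_forall_notMem]
  exact ⟨fun h e _ _ => h e, fun h e he =>
    have := (varsBelow_of_godelNumber_lt (Nat.lt_succ_self φ.godelNumber)).freeVars e he
    h e this this he⟩

theorem isSentence_primrec :
    PrimrecPred fun n => ∀ e < n + 1, e ∉ freeCode (n + 1) n :=
  PrimrecPred.ball_lt (p := fun y => y.2 ∉ freeCode (y.1 + 1) y.1) Primrec.succ
    (PrimrecPred.mem_list Primrec.snd ((codeRec_primrec Primrec.id freeStep_primrec).comp
      (Primrec.succ.comp Primrec.fst) Primrec.fst)).not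

/-- The local conditions for truth in the empty model. -/
def emptyStep (p : StepData ℕ) : Prop :=
  let t := p.2.1.unpair.1
  t = 0 ∨ t = 6 ∧ (0 ∈ p.2.2.2.1 ∨ 0 ∈ p.2.2.2.2) ∨ t = 7 ∧ (0 ∈ p.2.2.2.1 ∧ 0 ∈ p.2.2.2.2) ∨
    t = 9 ∨ t = 11

theorem emptyStep_primrec : PrimrecPred emptyStep := by
  have tag (k : ℕ) : PrimrecPred fun p : StepData ℕ => p.2.1.unpair.1 = k :=
    Primrec.eq.comp tag_primrec (Primrec.const k)
  have h1 := PrimrecPred.mem_list (Primrec.const 0) (fstSet_primrec (α := ℕ))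
  have h2 := PrimrecPred.mem_list (Primrec.const 0) (sndSet_primrec (α := ℕ))
  exact (tag 0).or <| ((tag 6).and (h1.or h2)).or <| ((tag 7).and (h1.and h2)).or <|
    (tag 9).or (tag 11)

/-- The set `{0}` or `∅`, depending on truth in the empty model. -/
noncomputable def emptyCode : ℕ → ℕ → List ℕ := codeRec (fun _ => 1) emptyStep

theorem zero_mem_emptyCode {φ : Formula A} : 0 ∈ emptyCode 0 φ.godelNumber ↔ φ.EmptySat := by
  induction φ with
  | top =>
    rw [godelNumber, show Nat.pair 0 0 = 0 from rfl, emptyCode, mem_codeRec_zero]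
    simp [emptyStep, EmptySat]
  | bot =>
    rw [godelNumber, show Nat.pair 1 0 = Nat.pair 1 (Nat.pair 0 0) from rfl, emptyCode,
      mem_codeRec_pair one_pos]
    simp [emptyStep, EmptySat]
  | _ =>
    rw [godelNumber, emptyCode, mem_codeRec_pair (by norm_num), ← emptyCode]
    simp [emptyStep, EmptySat, *]

theorem emptyCode_primrec : PrimrecPred fun n => 0 ∈ emptyCode 0 n :=
  PrimrecPred.mem_list (Primrec.const 0) ((codeRec_primrec (Primrec.const 1)
    emptyStep_primrec).comp (Primrec.const 0) Primrec.id)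

end Codes

end MonadicLogic

namespace MonadicLogic

open Formula

/-! ### Deciding semantic properties -/

/-- The digit `N + 1` is reserved for infinite classes; a finite class gets its size truncated at
`N`. -/
theorem exists_sigMatch {D : Type*} (L : Logic) (T N : ℕ) (κ : D → ℕ) :
    ∃ s < (N + 2) ^ T, SigMatch L T N s κ := by
  classical
  let f : ℕ → ℕ := fun c =>
    if (κ ⁻¹' {c}).Infinite then N + 1 else min (κ ⁻¹' {c}).ncard N
  obtain ⟨s, hs, hd⟩ := exists_digits (b := N + 2) (n := T) f fun i _ => by
    simp only [f]; split_ifs <;> omega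
  refine ⟨s, hs, fun c hc => ?_⟩
  rw [hd c hc]
  by_cases hinf : (κ ⁻¹' {c}).Infinite
  · have hf : f c = N + 1 := if_pos hinf
    rw [hf, hinf.encard_eq]
    refine ⟨?_, fun _ => iff_of_true rfl hinf⟩
    rw [min_eq_right le_top, min_eq_right]
    exact_mod_cast Nat.le_succ N
  · have hf : f c = min (κ ⁻¹' {c}).ncard N := if_neg hinf
    rw [hf]
    refine ⟨?_, fun _ => iff_of_false ?_ hinf⟩
    · rw [← (Set.not_infinite.1 hinf).cast_ncard_eq, Nat.mono_cast.map_min, min_assoc, min_self]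
    · omega

/-- Only the values of the variables below `N` matter. The constant assignment with value `g 0` is
matched first, and the variables are then moved to their values one at a time by
`Matches.exists_code`. -/
theorem exists_matches {D : Type*} {L : Logic} {T N s : ℕ} {κ : D → ℕ} (hκ : ∀ d, κ d < T)
    (hs : SigMatch L T N s κ) (hN : 0 < N) (g : ℕ → D) :
    ∃ e < (N * T) ^ N, Matches T N s κ g e := by
  have hT : 0 < T := (Nat.zero_le _).trans_lt (hκ (g 0))
  have key : ∀ k ≤ N, ∃ e < (N * T) ^ N,
      Matches T N s κ (fun x => if x < k then g x else g 0) e := by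
    intro k
    induction k with
    | zero =>
      intro _
      -- The number `κ (g 0)` is the element with index `0` in its colour class.
      have hd : κ (g 0) < N * T := (hκ _).trans_le (Nat.le_mul_of_pos_left T hN)
      obtain ⟨e, he, hdig⟩ := exists_digits (b := N * T) (n := N) (fun _ => κ (g 0)) fun _ _ => hd
      refine ⟨e, he, fun x hx => ?_⟩
      rw [hdig x hx, InDom, Nat.mod_eq_of_lt (hκ _), Nat.div_eq_of_lt (hκ _)]
      refine ⟨?_, by simp, fun y hy => by simp [hdig y hy]⟩
      -- The colour of `g 0` is inhabited and `N` is positive, so the digit of this colour is not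
      -- zero.
      by_contra h0
      have h1 := (hs _ (hκ (g 0))).1
      rw [Nat.eq_zero_of_not_pos h0] at h1
      have h2 : (κ ⁻¹' {κ (g 0)}).encard ≠ 0 := by
        rw [Ne, Set.encard_eq_zero]
        exact Set.Nonempty.ne_empty ⟨g 0, rfl⟩
      have h3 : (N : ℕ∞) ≠ 0 := by exact_mod_cast hN.ne'
      simp only [Nat.cast_zero, zero_min, min_eq_zero] at h1
      tauto
    | succ k ih =>
      intro hk
      obtain ⟨e, he, hm⟩ := ih (by omega)
      obtain ⟨e', he', -, -, hm'⟩ := hm.exists_code hκ hs hk (g k)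
      refine ⟨e', he', ?_⟩
      convert hm' using 1
      funext x
      by_cases hx : x = k
      · subst hx; simp
      · rw [Function.update_of_ne hx]
        exact if_congr (by omega) rfl rfl
  obtain ⟨e, he, hm⟩ := key N le_rfl
  refine ⟨e, he, fun x hx => ?_⟩
  have := hm x hx
  simp only [hx, if_true] at this
  exact ⟨this.1, this.2.1, fun y hy => by simpa [hy] using this.2.2 y hy⟩

/-- Every coded structure with an assignment is realised by a coloured set. -/
theorem exists_realisation {T N s e : ℕ} (hT : 0 < T) (hN : 0 < N)
    (he : ∀ x < N, InDom T N s (digit (N * T) e x)) :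
    ∃ (D : Type u) (κ : D → ℕ) (g : ℕ → D), (∀ d, κ d < T) ∧ (∀ L, SigMatch L T N s κ) ∧
      Matches T N s κ g e := by
  -- Elements are pairs of a colour and an index. A flagged class takes all natural numbers as
  -- indices and becomes infinite; any other class takes exactly as many as its digit says.
  let p : ℕ × ℕ → Prop := fun q => q.1 < T ∧
    (q.2 < digit (N + 2) s q.1 ∨ digit (N + 2) s q.1 = N + 1)
  let D := ULift.{u} {q : ℕ × ℕ // p q}
  let κ : D → ℕ := fun d => d.down.1.1
  let pt : ∀ x < N, D := fun x hx => ⟨⟨(digit (N * T) e x % T, digit (N * T) e x / T),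
    Nat.mod_lt _ hT, Or.inl (he x hx)⟩⟩
  let g : ℕ → D := fun x => if hx : x < N then pt x hx else pt 0 hN
  have hg (x : ℕ) (hx : x < N) : g x = pt x hx := dif_pos hx
  refine ⟨D, κ, g, fun d => d.down.2.1, fun L c hc => ?_, fun x hx => ⟨he x hx, ?_, ?_⟩⟩
  · have himg : (κ ⁻¹' {c}).encard =
        {i | i < digit (N + 2) s c ∨ digit (N + 2) s c = N + 1}.encard := by
      have : (fun d : D => d.down.1.2) '' (κ ⁻¹' {c}) =
          {i | i < digit (N + 2) s c ∨ digit (N + 2) s c = N + 1} := by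
        ext i
        constructor
        · rintro ⟨⟨⟨q, hq⟩⟩, rfl, rfl⟩
          exact hq.2
        · exact fun hi => ⟨⟨⟨(c, i), hc, hi⟩⟩, rfl, rfl⟩
      rw [← this, Set.InjOn.encard_image]
      rintro ⟨⟨⟨q1, q2⟩, hq⟩⟩ h1 ⟨⟨⟨r1, r2⟩, hr⟩⟩ h2 h3
      simp only [κ, Set.mem_preimage, Set.mem_singleton_iff] at h1 h2 h3
      subst h1 h3
      subst h2
      rfl
    by_cases hd : digit (N + 2) s c = N + 1
    · have htop : (κ ⁻¹' {c}).encard = ⊤ := by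
        rw [himg, show {i | i < digit (N + 2) s c ∨ digit (N + 2) s c = N + 1} = Set.univ from
          Set.eq_univ_of_forall fun i => Or.inr hd]
        exact Set.infinite_univ.encard_eq
      refine ⟨?_, fun _ => iff_of_true hd (Set.encard_eq_top_iff.1 htop)⟩
      rw [htop, hd, min_eq_right le_top, min_eq_right]
      exact_mod_cast Nat.le_succ N
    · have hfin : (κ ⁻¹' {c}).encard = digit (N + 2) s c := by
        rw [himg, show {i | i < digit (N + 2) s c ∨ digit (N + 2) s c = N + 1} =
          ((Finset.range (digit (N + 2) s c) : Finset ℕ) : Set ℕ) by ext i; simp [hd],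
          Set.encard_coe_eq_coe_finsetCard, Finset.card_range]
      refine ⟨by rw [hfin], fun _ => iff_of_false hd fun hinf => ?_⟩
      rw [hinf.encard_eq] at hfin
      exact ENat.top_ne_natCast _ hfin
  · rw [hg x hx]
  · intro y hy
    rw [hg x hx, hg y hy]
    constructor
    · intro h
      simp only [pt, h]
    · intro h
      have h' := congrArg (fun d : D => d.down.1) h
      simp only [pt, Prod.mk.injEq] at h'
      rw [← Nat.mod_add_div (digit (N * T) e x) T, h'.1, h'.2, Nat.mod_add_div]

/-- In all coded structures, the assignments that satisfy the formula with Gödel number `n` under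
the interpretation `W` satisfy the formula with Gödel number `k` under `W'`. -/
def CodeEntails (T : ℕ) (W W' : List (ℕ × ℕ)) (N n k : ℕ) : Prop :=
  ∀ s < (N + 2) ^ T, ∀ e < (N * T) ^ N, (∀ x < N, InDom T N s (digit (N * T) e x)) →
    e ∈ evalCode T W (N, s) n → e ∈ evalCode T W' (N, s) k

theorem codeEntails_primrec {α : Type*} [Primcodable α] (T : ℕ) (W W' : List (ℕ × ℕ))
    {N n k : α → ℕ} (hN : Primrec N) (hn : Primrec n) (hk : Primrec k) :
    PrimrecPred fun a => CodeEntails T W W' (N a) (n a) (k a) := by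
  have hN1 := hN.comp (Primrec.fst (α := α) (β := ℕ))
  have hN2 := hN1.comp (Primrec.fst (α := α × ℕ) (β := ℕ))
  have hb2 := Primrec.nat_mul.comp hN2 (Primrec.const T)
  have hs2 : Primrec fun q : (α × ℕ) × ℕ => q.1.2 := Primrec.snd.comp Primrec.fst
  refine PrimrecPred.ball_lt (p := fun q => ∀ e < (N q.1 * T) ^ N q.1,
    (∀ x < N q.1, InDom T (N q.1) q.2 (digit (N q.1 * T) e x)) →
    e ∈ evalCode T W (N q.1, q.2) (n q.1) → e ∈ evalCode T W' (N q.1, q.2) (k q.1))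
    (Primrec.nat_pow.comp (Primrec.nat_add.comp hN (Primrec.const 2)) (Primrec.const T)) ?_
  refine PrimrecPred.ball_lt (p := fun q : (α × ℕ) × ℕ =>
    (∀ x < N q.1.1, InDom T (N q.1.1) q.1.2 (digit (N q.1.1 * T) q.2 x)) →
    q.2 ∈ evalCode T W (N q.1.1, q.1.2) (n q.1.1) →
    q.2 ∈ evalCode T W' (N q.1.1, q.1.2) (k q.1.1))
    (Primrec.nat_pow.comp (Primrec.nat_mul.comp hN1 (Primrec.const T)) hN1) ?_
  refine PrimrecPred.imp ?_ (PrimrecPred.imp ?_ ?_)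
  · exact PrimrecPred.ball_lt (p := fun q : ((α × ℕ) × ℕ) × ℕ =>
      InDom T (N q.1.1.1) q.1.1.2 (digit (N q.1.1.1 * T) q.1.2 q.2)) hN2
      (inDom_primrec T (hN2.comp Primrec.fst) (hs2.comp Primrec.fst)
        (digit_primrec (hb2.comp Primrec.fst) (Primrec.snd.comp Primrec.fst) Primrec.snd))
  · exact PrimrecPred.mem_list Primrec.snd ((evalCode_primrec T W).comp (hN2.pair hs2)
      (hn.comp (Primrec.fst.comp Primrec.fst)))
  · exact PrimrecPred.mem_list Primrec.snd ((evalCode_primrec T W').comp (hN2.pair hs2)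
      (hk.comp (Primrec.fst.comp Primrec.fst)))

section Entailment

variable {A : Type v} [Encodable A] {C : Type*} {T : ℕ} (ι : C ≃ Fin T)

/-- The valuation on a coloured set under which a symbol is true at its colours. -/
def colourVal {D : Type u} (P : A → Set C) (κ : D → C) : A → Set D := fun a => κ ⁻¹' P a

/-- Reduces an entailment over all non-empty models to a bounded check: every model has a coded
counterpart and every coded structure that carries an assignment is realised. The two sides may
interpret the symbols differently over the same colours, which monotonicity needs. -/
theorem codeEntails_iff {P P' : A → Set C} {W W' : List (ℕ × ℕ)}
    (hW : ∀ a c, (Encodable.encode a, (ι c : ℕ)) ∈ W ↔ c ∈ P a)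
    (hW' : ∀ a c, (Encodable.encode a, (ι c : ℕ)) ∈ W' ↔ c ∈ P' a) {L : Logic}
    {φ ψ : Formula A} (hφ : φ.InLogic L) (hψ : ψ.InLogic L) {N : ℕ} (hN : 0 < N)
    (hφN : φ.VarsBelow N) (hψN : ψ.VarsBelow N) :
    CodeEntails T W W' N φ.godelNumber ψ.godelNumber ↔
      ∀ (D : Type u) (κ : D → C) (g : ℕ → D),
        φ.Sat (colourVal P κ) g → ψ.Sat (colourVal P' κ) g := by
  constructor
  · intro h D κ g hg
    have hκ (d : D) : (ι (κ d) : ℕ) < T := (ι (κ d)).2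
    obtain ⟨s, hs, hsig⟩ := exists_sigMatch L T N fun d => (ι (κ d) : ℕ)
    obtain ⟨e, he, hm⟩ := exists_matches hκ hsig hN g
    have h1 := sat_iff_mem_evalCode (V := colourVal P κ) (W := W) (fun a d => hW a (κ d)) hκ hsig
      hφ hφN he hm
    have h2 := sat_iff_mem_evalCode (V := colourVal P' κ) (W := W') (fun a d => hW' a (κ d)) hκ
      hsig hψ hψN he hm
    exact h2.2 (h s hs e he (fun x hx => (hm x hx).1) (h1.1 hg))
  · intro h s _ e he hdom hmem
    -- With no colours there would be no assignment code, because `(N * 0) ^ N = 0` for positive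
    -- `N`.
    have hT : 0 < T := by
      rcases Nat.eq_zero_or_pos T with rfl | hT
      · rw [mul_zero, zero_pow hN.ne'] at he
        omega
      · exact hT
    obtain ⟨D, κ, g, hκ, hsig, hm⟩ := exists_realisation.{u} hT hN hdom
    let κ' : D → C := fun d => ι.symm ⟨κ d, hκ d⟩
    have hκ' (d : D) : (ι (κ' d) : ℕ) = κ d := by simp [κ']
    have h1 := sat_iff_mem_evalCode (V := colourVal P κ') (W := W)
      (fun a d => by rw [← hκ' d, hW]; rfl) hκ (hsig L) hφ hφN he hm
    have h2 := sat_iff_mem_evalCode (V := colourVal P' κ') (W := W')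
      (fun a d => by rw [← hκ' d, hW']; rfl) hκ (hsig L) hψ hψN he hm
    exact h2.1 (h D κ' g (h1.2 hmem))

theorem exists_interpretation [Finite A] [Finite C] (P : A → Set C) :
    ∃ W : List (ℕ × ℕ), ∀ a c, (Encodable.encode a, (ι c : ℕ)) ∈ W ↔ c ∈ P a := by
  have hfin : {q : A × C | q.2 ∈ P q.1}.Finite := Set.toFinite _
  refine ⟨hfin.toFinset.toList.map fun q => (Encodable.encode q.1, (ι q.2 : ℕ)), fun a c => ?_⟩
  simp only [List.mem_map, Finset.mem_toList, Set.Finite.mem_toFinset, Set.mem_ofPred_eq,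
    Prod.mk.injEq, Encodable.encode_inj, Fin.val_inj, ι.injective.eq_iff]
  constructor
  · rintro ⟨⟨a', c'⟩, h, rfl, rfl⟩
    exact h
  · exact fun h => ⟨(a, c), h, rfl, rfl⟩

end Entailment

/-- Two formulas have the same truth value in all non-empty models under all assignments. -/
def SatEquiv {A : Type v} (φ ψ : Formula A) : Prop :=
  ∀ (D : Type u) (V : A → Set D) (g : ℕ → D), φ.Sat V g ↔ ψ.Sat V g

/-- The types of elements in a pair of valuations of which the second is a `B`-extension of the
first. -/
abbrev ExtColour {A : Type v} (B : Set A) :=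
  {q : Set A × Set A // (∀ b ∈ B, b ∈ q.1 → b ∈ q.2) ∧ ∀ a, a ∉ B → (a ∈ q.1 ↔ a ∈ q.2)}

variable {A : Type v}

/-- Each element is coloured by its pair of types under the two valuations; the constraint on the
pairs expresses exactly that the second valuation is a `B`-extension. -/
theorem monotoneIn_iff {B : Set A} {φ : Formula A} :
    MonotoneIn.{u} B φ ↔ ∀ (D : Type u) (κ : D → ExtColour B) (g : ℕ → D),
      φ.Sat (colourVal (fun a => {c | a ∈ c.1.1}) κ) g →
        φ.Sat (colourVal (fun a => {c | a ∈ c.1.2}) κ) g := by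
  constructor
  · intro h D κ g
    refine h D _ _ ⟨fun b hb d hd => (κ d).2.1 b hb hd, fun a ha => ?_⟩ g
    ext d
    exact (κ d).2.2 a ha
  · intro h D V V' hV g
    exact h D (fun d => ⟨({a | d ∈ V a}, {a | d ∈ V' a}), fun b hb hd => hV.1 b hb hd,
      fun a ha => by simp [hV.2 a ha]⟩) g

theorem satEquiv_iff {φ ψ : Formula A} :
    SatEquiv.{u} φ ψ ↔
      (∀ (D : Type u) (κ : D → Set A) (g : ℕ → D), φ.Sat (colourVal (fun a => {c | a ∈ c}) κ) g →
        ψ.Sat (colourVal (fun a => {c | a ∈ c}) κ) g) ∧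
      ∀ (D : Type u) (κ : D → Set A) (g : ℕ → D), ψ.Sat (colourVal (fun a => {c | a ∈ c}) κ) g →
        φ.Sat (colourVal (fun a => {c | a ∈ c}) κ) g := by
  constructor
  · exact fun h => ⟨fun D κ g => (h D _ g).1, fun D κ g => (h D _ g).2⟩
  · exact fun h D V g => ⟨h.1 D (fun d => {a | d ∈ V a}) g, h.2 D (fun d => {a | d ∈ V a}) g⟩

/-- Monotonicity is a primitive recursive property of Gödel numbers. -/
theorem exists_primrec_monotoneIn [Finite A] [Encodable A] (L : Logic) (B : Set A) :
    ∃ p : ℕ → Prop, PrimrecPred p ∧ ∀ φ : Formula A, φ.InLogic L →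
      (p φ.godelNumber ↔ MonotoneIn.{u} B φ) := by
  let ι := Finite.equivFin (ExtColour B)
  obtain ⟨W, hW⟩ := exists_interpretation (A := A) ι fun a => {c | a ∈ c.1.1}
  obtain ⟨W', hW'⟩ := exists_interpretation (A := A) ι fun a => {c | a ∈ c.1.2}
  refine ⟨_, codeEntails_primrec (Nat.card (ExtColour B)) W W' Primrec.succ Primrec.id Primrec.id, fun φ hφ => ?_⟩
  have hN := varsBelow_of_godelNumber_lt (Nat.lt_succ_self φ.godelNumber)
  rw [monotoneIn_iff]
  exact codeEntails_iff ι hW hW' hφ hφ (Nat.succ_pos _) hN hN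

/-- Equivalence is a primitive recursive relation between Gödel numbers. -/
theorem exists_primrec_satEquiv (A : Type v) [Finite A] [Encodable A] (L : Logic) :
    ∃ p : ℕ × ℕ → Prop, PrimrecPred p ∧ ∀ φ ψ : Formula A, φ.InLogic L → ψ.InLogic L →
      (p (φ.godelNumber, ψ.godelNumber) ↔ SatEquiv.{u} φ ψ) := by
  let ι := Finite.equivFin (Set A)
  obtain ⟨W, hW⟩ := exists_interpretation (A := A) ι fun a => {c | a ∈ c}
  have hsum : Primrec fun q : ℕ × ℕ => q.1 + q.2 + 1 :=
    Primrec.succ.comp (Primrec.nat_add.comp Primrec.fst Primrec.snd)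
  refine ⟨_, (codeEntails_primrec (Nat.card (Set A)) W W hsum Primrec.fst Primrec.snd).and
    (codeEntails_primrec (Nat.card (Set A)) W W hsum Primrec.snd Primrec.fst), fun φ ψ hφ hψ => ?_⟩
  have h1 : φ.VarsBelow (φ.godelNumber + ψ.godelNumber + 1) :=
    varsBelow_of_godelNumber_lt (by omega)
  have h2 : ψ.VarsBelow (φ.godelNumber + ψ.godelNumber + 1) :=
    varsBelow_of_godelNumber_lt (by omega)
  rw [satEquiv_iff]
  exact and_congr (codeEntails_iff ι hW hW hφ hψ (Nat.succ_pos _) h1 h2)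
    (codeEntails_iff ι hW hW hψ hφ (Nat.succ_pos _) h2 h1)

end MonadicLogic

namespace MonadicLogic

open Formula

/-! ### Positive normal forms -/

/-- The elements of a set in a finite type. -/
noncomputable def listOf {C : Type*} [Finite C] (s : Set C) : List C :=
  (Set.toFinite s).toFinset.toList

theorem mem_listOf {C : Type*} [Finite C] {s : Set C} {c : C} : c ∈ listOf s ↔ c ∈ s := by
  simp [listOf]

namespace Formula

variable {A : Type v}

/-- Conjunction of a list of formulas. -/
def conj (l : List (Formula A)) : Formula A := l.foldr and top

/-- Disjunction of a list of formulas. -/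
def disj (l : List (Formula A)) : Formula A := l.foldr or bot

variable {D : Type u} {V : A → Set D} {g : ℕ → D} {l : List (Formula A)}

theorem sat_conj : (conj l).Sat V g ↔ ∀ φ ∈ l, φ.Sat V g := by
  induction l with
  | nil => simp [conj, Sat]
  | cons φ l ih => simp only [conj, List.foldr_cons, Sat, List.forall_mem_cons] at ih ⊢; rw [ih]

theorem sat_disj : (disj l).Sat V g ↔ ∃ φ ∈ l, φ.Sat V g := by
  induction l with
  | nil => simp [disj, Sat]
  | cons φ l ih => simp only [disj, List.foldr_cons, Sat, List.exists_mem_cons_iff] at ih ⊢; rw [ih]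

/-- The formula is `B`-positive and its free variables lie in `X`. -/
def PositiveOn (L : Logic) (B : Set A) (X : Set ℕ) (φ : Formula A) : Prop :=
  φ.Positive L B ∧ φ.freeVars ⊆ X

variable {L : Logic} {B : Set A} {X : Set ℕ}

theorem PositiveOn.top : (top : Formula A).PositiveOn L B X :=
  ⟨positive_of_negIn trivial trivial, Set.empty_subset _⟩

theorem PositiveOn.bot : (bot : Formula A).PositiveOn L B X :=
  ⟨positive_of_negIn trivial trivial, Set.empty_subset _⟩

theorem PositiveOn.and {φ ψ : Formula A} (hφ : φ.PositiveOn L B X) (hψ : ψ.PositiveOn L B X) :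
    (φ.and ψ).PositiveOn L B X :=
  ⟨.and _ _ hφ.1 hψ.1, Set.union_subset hφ.2 hψ.2⟩

theorem PositiveOn.or {φ ψ : Formula A} (hφ : φ.PositiveOn L B X) (hψ : ψ.PositiveOn L B X) :
    (φ.or ψ).PositiveOn L B X :=
  ⟨.or _ _ hφ.1 hψ.1, Set.union_subset hφ.2 hψ.2⟩

theorem PositiveOn.ex {φ : Formula A} {x : ℕ} (hφ : φ.PositiveOn L B (insert x X)) :
    (φ.ex x).PositiveOn L B X :=
  ⟨.ex _ _ hφ.1, by simpa [freeVars, Set.sdiff_subset_iff] using hφ.2⟩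

theorem PositiveOn.all {φ : Formula A} {x : ℕ} (hφ : φ.PositiveOn L B (insert x X)) :
    (φ.all x).PositiveOn L B X :=
  ⟨.all _ _ hφ.1, by simpa [freeVars, Set.sdiff_subset_iff] using hφ.2⟩

theorem PositiveOn.exInf {φ : Formula A} {x : ℕ} (hL : L = Logic.FOEinf)
    (hφ : φ.PositiveOn L B (insert x X)) : (φ.exInf x).PositiveOn L B X :=
  ⟨.exInf _ _ hL hφ.1, by simpa [freeVars, Set.sdiff_subset_iff] using hφ.2⟩

theorem PositiveOn.allInf {φ : Formula A} {x : ℕ} (hL : L = Logic.FOEinf)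
    (hφ : φ.PositiveOn L B (insert x X)) : (φ.allInf x).PositiveOn L B X :=
  ⟨.allInf _ _ hL hφ.1, by simpa [freeVars, Set.sdiff_subset_iff] using hφ.2⟩

theorem PositiveOn.equal {x y : ℕ} (hL : L ≠ Logic.M) (hx : x ∈ X) (hy : y ∈ X) :
    (equal x y : Formula A).PositiveOn L B X :=
  ⟨positive_of_negIn hL trivial, by rintro z (rfl | rfl) <;> assumption⟩

theorem PositiveOn.nequal {x y : ℕ} (hL : L ≠ Logic.M) (hx : x ∈ X) (hy : y ∈ X) :
    (nequal x y : Formula A).PositiveOn L B X :=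
  ⟨positive_of_negIn hL trivial, by rintro z (rfl | rfl) <;> assumption⟩

theorem PositiveOn.conj (h : ∀ φ ∈ l, φ.PositiveOn L B X) : (conj l).PositiveOn L B X := by
  induction l with
  | nil => exact .top
  | cons φ l ih => exact .and (h φ (by simp)) (ih fun ψ hψ => h ψ (by simp [hψ]))

theorem PositiveOn.disj (h : ∀ φ ∈ l, φ.PositiveOn L B X) : (disj l).PositiveOn L B X := by
  induction l with
  | nil => exact .bot
  | cons φ l ih => exact .or (h φ (by simp)) (ih fun ψ hψ => h ψ (by simp [hψ]))

theorem PositiveOn.isSentence {φ : Formula A} (h : φ.PositiveOn L B ∅) : φ.IsSentence :=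
  Set.subset_empty_iff.1 h.2

end Formula

section Types

variable {A : Type v} {D : Type u}

/-- The element `d` realises the `B`-positive type that corresponds to `c`. -/
def TypeLe (B : Set A) (V : A → Set D) (c : Set A) (d : D) : Prop :=
  ∀ a, (a ∈ c → d ∈ V a) ∧ (a ∉ c → a ∉ B → d ∉ V a)

/-- The valuation given by a colouring with sets of predicate symbols. -/
def typeVal (κ : D → Set A) : A → Set D := fun a => {d | a ∈ κ d}

/-- Links the normal form to monotonicity: choosing at each element a type that it realises
positively produces a valuation of which `V` is a `B`-extension. -/
theorem bExtension_typeVal {B : Set A} {V : A → Set D} {κ : D → Set A}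
    (h : ∀ d, TypeLe B V (κ d) d) : BExtension B (typeVal κ) V :=
  ⟨fun b _ d hd => (h d b).1 hd, fun a ha => Set.ext fun d =>
    ⟨fun hd => (h d a).1 hd, fun hd => by_contra fun hn => (h d a).2 hn ha hd⟩⟩

theorem typeLe_typeOf (B : Set A) (V : A → Set D) (d : D) : TypeLe B V {a | d ∈ V a} d :=
  fun _ => ⟨fun h => h, fun h _ => h⟩

variable [Finite A]

open Classical in
/-- The `B`-positive formula that describes the type `c`. -/
noncomputable def typeFormula (B : Set A) (c : Set A) (x : ℕ) : Formula A :=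
  conj ((listOf Set.univ).map fun a => if a ∈ c then pos a x else if a ∈ B then top else neg a x)

theorem sat_typeFormula {B : Set A} {V : A → Set D} {c : Set A} {x : ℕ} {g : ℕ → D} :
    (typeFormula B c x).Sat V g ↔ TypeLe B V c (g x) := by
  simp only [typeFormula, sat_conj, List.mem_map, mem_listOf, Set.mem_univ, true_and,
    forall_exists_index, forall_apply_eq_imp_iff, TypeLe]
  refine forall_congr' fun a => ?_
  split_ifs with h1 h2 <;> simp_all [Sat]

theorem positiveOn_typeFormula {L : Logic} {B : Set A} {c : Set A} {x : ℕ} {X : Set ℕ}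
    (hx : x ∈ X) : (typeFormula B c x).PositiveOn L B X := by
  refine .conj fun φ hφ => ?_
  obtain ⟨a, -, rfl⟩ := List.mem_map.1 hφ
  split_ifs with h1 h2
  · exact ⟨positive_of_negIn trivial trivial, by simpa [freeVars] using hx⟩
  · exact .top
  · exact ⟨positive_of_negIn trivial h2, by simpa [freeVars] using hx⟩

/-- There are distinct elements that realise the types in the list and are different from the values
of the variables below `k`; these elements are named by variables from `k` on. -/
noncomputable def exBlock (B : Set A) (ψ : Formula A) : ℕ → List (Set A) → Formula A
  | _, [] => ψ
  | k, c :: cs => ex k (((typeFormula B c k).and (conj ((List.range k).map (nequal k)))).and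
      (exBlock B ψ (k + 1) cs))

theorem positiveOn_exBlock {L : Logic} (hL : L ≠ Logic.M) {B : Set A} {ψ : Formula A} :
    ∀ {k : ℕ} {cs : List (Set A)}, ψ.PositiveOn L B (Set.Iio (k + cs.length)) →
      (exBlock B ψ k cs).PositiveOn L B (Set.Iio k)
  | k, [], h => h
  | k, c :: cs, h => by
    have hk : insert k (Set.Iio k) = Set.Iio (k + 1) := by
      ext; simp only [Set.mem_insert_iff, Set.mem_Iio]; omega
    refine .ex (hk ▸ .and (.and (positiveOn_typeFormula (by simp)) (.conj fun φ hφ => ?_))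
      (positiveOn_exBlock hL (by convert h using 2; simp; omega)))
    obtain ⟨j, hj, rfl⟩ := List.mem_map.1 hφ
    exact .nequal hL (by simp) (by simp at hj ⊢; omega)

open Classical in
-- The quantified witnesses form a partial colouring `f` with prescribed finite class sizes,
-- disjoint from the values already named. The predicate `P` abstracts from `ψ`, whose truth is
-- assumed to depend only on the set of named elements.
theorem sat_exBlock {B : Set A} {V : A → Set D} {ψ : Formula A} {P : Set D → Prop} :
    ∀ {k : ℕ} {cs : List (Set A)} {g : ℕ → D},
      (∀ g : ℕ → D, ψ.Sat V g ↔ P (g '' Set.Iio (k + cs.length))) →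
      ((exBlock B ψ k cs).Sat V g ↔ ∃ f : D → Option (Set A),
        (∀ c, {d | f d = some c}.encard = cs.count c) ∧
        (∀ d c, f d = some c → TypeLe B V c d ∧ d ∉ g '' Set.Iio k) ∧
        P (g '' Set.Iio k ∪ {d | f d ≠ none}))
  | k, [], g, h => by
    rw [exBlock, h g]
    constructor
    · exact fun hP => ⟨fun _ => none, by simp, by simp, by simpa using hP⟩
    · rintro ⟨f, h1, -, h3⟩
      have hf : {d | f d ≠ none} = ∅ := by
        refine Set.eq_empty_of_forall_notMem fun d hd => ?_
        obtain ⟨c, hc⟩ := Option.ne_none_iff_exists'.1 hd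
        have := h1 c
        rw [List.count_nil, Nat.cast_zero, Set.encard_eq_zero] at this
        exact (this ▸ hc : d ∈ (∅ : Set D))
      simpa [hf] using h3
  | k, c :: cs, g, h => by
    have himg (d : D) : Function.update g k d '' Set.Iio (k + 1) = insert d (g '' Set.Iio k) := by
      rw [show Set.Iio (k + 1) = insert k (Set.Iio k) by
        ext; simp only [Set.mem_insert_iff, Set.mem_Iio]; omega, Set.image_insert_eq,
        Function.update_self]
      congr 1
      exact Set.image_congr fun j hj => Function.update_of_ne (ne_of_lt hj) _ _
    have ih (d : D) := sat_exBlock (B := B) (V := V) (P := P) (k := k + 1) (cs := cs)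
      (g := Function.update g k d) (ψ := ψ)
      (fun g => by rw [h g, List.length_cons, add_right_comm, add_assoc])
    have hdist (d : D) : (conj ((List.range k).map (nequal k))).Sat V (Function.update g k d) ↔
        d ∉ g '' Set.Iio k := by
      simp only [sat_conj, List.mem_map, List.mem_range, forall_exists_index, and_imp,
        forall_apply_eq_imp_iff₂, Sat, Function.update_self, Set.mem_image, Set.mem_Iio, not_exists,
        not_and]
      refine forall₂_congr fun j hj => ?_
      rw [Function.update_of_ne (ne_of_lt hj), ne_comm]
    rw [exBlock]
    simp only [Sat, ih, hdist, himg, sat_typeFormula, Function.update_self]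
    constructor
    · rintro ⟨d, ⟨hd, hdk⟩, f, h1, h2, h3⟩
      -- The later witnesses avoid all named elements, and `d` is named by now; so `d` can be added
      -- to the colouring.
      have hfd : f d = none := by
        by_contra hne
        obtain ⟨c', hc'⟩ := Option.ne_none_iff_exists'.1 hne
        exact (h2 d c' hc').2 (Set.mem_insert _ _)
      refine ⟨Function.update f d (some c), fun c' => ?_, fun d' c' hd' => ?_, ?_⟩
      · by_cases hc : c' = c
        · subst hc
          rw [show {x | Function.update f d (some c') x = some c'} = insert d {x | f x = some c'} by
            ext x; by_cases hx : x = d <;> simp [hx], Set.encard_insert_of_notMem (by simp [hfd]),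
            h1, List.count_cons_self]
          rfl
        · rw [List.count_cons_of_ne (Ne.symm hc), ← h1]
          congr 1
          ext x
          by_cases hx : x = d
          · subst hx; simp [hfd, Ne.symm hc]
          · simp [hx]
      · by_cases hx : d' = d
        · subst hx
          rw [Function.update_self, Option.some_inj] at hd'
          exact ⟨hd' ▸ hd, hdk⟩
        · rw [Function.update_of_ne hx] at hd'
          exact ⟨(h2 d' c' hd').1, fun hmem => (h2 d' c' hd').2 (Set.mem_insert_of_mem _ hmem)⟩
      · convert h3 using 1
        ext x
        by_cases hx : x = d <;> simp [hx]
    · rintro ⟨f, h1, h2, h3⟩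
      obtain ⟨d, hd⟩ : {x | f x = some c}.Nonempty := by
        rw [← Set.encard_ne_zero, h1, List.count_cons_self]
        exact Nat.cast_ne_zero.2 (Nat.succ_ne_zero _)
      refine ⟨d, h2 d c hd, Function.update f d none, fun c' => ?_, fun d' c' hd' => ?_, ?_⟩
      · by_cases hc : c' = c
        · subst hc
          have h4 := h1 c'
          rw [List.count_cons_self, ← Set.encard_sdiff_singleton_add_one hd, Nat.cast_add,
            Nat.cast_one] at h4
          rw [← WithTop.add_right_cancel ENat.one_ne_top h4]
          congr 1
          ext x
          by_cases hx : x = d <;> simp [hx]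
        · rw [← List.count_cons_of_ne (Ne.symm hc), ← h1]
          congr 1
          ext x
          by_cases hx : x = d
          · subst hx
            have : f x = some c := hd
            simp [this, Ne.symm hc]
          · simp [hx]
      · have hx : d' ≠ d := by
          rintro rfl
          simp at hd'
        rw [Function.update_of_ne hx] at hd'
        refine ⟨(h2 d' c' hd').1, fun hmem => ?_⟩
        exact (h2 d' c' hd').2 ((Set.mem_insert_iff.1 hmem).resolve_left hx)
      · convert h3 using 1
        ext x
        by_cases hx : x = d
        · subst hx
          have : f x = some c := hd
          simp [this]
        · simp [hx]

end Types

end MonadicLogic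

namespace MonadicLogic

open Formula

/-! ### Disjoint infinite subsets of infinite sets. -/

section DisjointSubsets

variable {D : Type*}

/-- Distinct representatives of a sequence of infinite sets. -/
noncomputable def representatives (X : ℕ → Set D) (hX : ∀ n, (X n).Infinite) (n : ℕ) : D :=
  (((hX n).sdiff (Set.finite_range fun m : Fin n => representatives X hX m)).nonempty).some
termination_by n
decreasing_by exact m.2

theorem representatives_mem {X : ℕ → Set D} (hX : ∀ n, (X n).Infinite) (n : ℕ) :
    representatives X hX n ∈ X n ∧ ∀ m < n, representatives X hX m ≠ representatives X hX n := by
  have h := (((hX n).sdiff (Set.finite_range fun m : Fin n =>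
    representatives X hX m)).nonempty).some_mem
  rw [← representatives] at h
  exact ⟨h.1, fun m hm heq => h.2 ⟨⟨m, hm⟩, heq⟩⟩

theorem representatives_injective {X : ℕ → Set D} (hX : ∀ n, (X n).Infinite) :
    Function.Injective (representatives X hX) := by
  intro m n h
  rcases lt_trichotomy m n with hlt | heq | hlt
  · exact absurd h ((representatives_mem hX n).2 m hlt)
  · exact heq
  · exact absurd h.symm ((representatives_mem hX m).2 n hlt)

/-- Infinite sets indexed by a countable set have pairwise disjoint infinite subsets. -/
theorem exists_disjoint_infinite_subsets {C : Type*} {I : Set C} (hI : I.Countable) {X : C → Set D}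
    (hX : ∀ c ∈ I, (X c).Infinite) :
    ∃ S : C → Set D, (∀ c ∈ I, (S c).Infinite) ∧ (∀ c, S c ⊆ X c) ∧
      (∀ c, (S c).Nonempty → c ∈ I) ∧ ∀ d c c', d ∈ S c → d ∈ S c' → c = c' := by
  rcases I.eq_empty_or_nonempty with rfl | hne
  · exact ⟨fun _ => ∅, by simp, by simp, by simp, by simp⟩
  obtain ⟨p, rfl⟩ := hI.exists_eq_range hne
  -- Indexing by the first component of `Nat.unpair` lets every set occur infinitely often in the
  -- sequence, so it receives infinitely many of the distinct representatives.
  have hX' (n : ℕ) : (X (p n.unpair.1)).Infinite := hX _ ⟨_, rfl⟩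
  have hmem := fun n => (representatives_mem hX' n).1
  have hinj := representatives_injective hX'
  refine ⟨fun c => representatives _ hX' '' {n | p n.unpair.1 = c}, ?_, ?_, ?_, ?_⟩
  · rintro _ ⟨i, rfl⟩
    refine Set.Infinite.image hinj.injOn ?_
    refine (Set.infinite_range_of_injective (f := fun j => Nat.pair i j) ?_).mono ?_
    · intro j j' h
      simpa [Nat.pair_eq_pair] using h
    · rintro _ ⟨j, rfl⟩
      simp
  · rintro c _ ⟨n, rfl, rfl⟩
    exact hmem n
  · rintro c ⟨_, n, rfl, -⟩
    exact ⟨_, rfl⟩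
  · rintro d _ _ ⟨n, rfl, rfl⟩ ⟨n', rfl, h⟩
    rw [hinj h]

end DisjointSubsets

/-! ### Colourings with a prescribed signature and the sentences that describe them. -/

section Colourings

variable {A : Type v} [Finite A] {D : Type u}

/-- A partial colouring that satisfies the conditions of a normal form extends to a colouring with
the given signature, and every such colouring arises in this way. The colours in `I` have infinitely
many elements, and `R c d` says that `d` may get the colour `c`. -/
theorem exists_colouring_iff {C : Type*} [Finite C] {R : C → D → Prop} {N : ℕ} {m : C → ℕ}
    (hm : ∀ c, m c ≤ N) {I : Set C} (hI : ∀ c ∈ I, m c = N) (gen : Prop) :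
    (∃ f : D → Option C, (∀ c, {d | f d = some c}.encard = m c) ∧
      (∀ d c, f d = some c → R c d) ∧ (∀ d, f d ≠ none ∨ ∃ c, m c = N ∧ R c d) ∧
      (gen → {d | ¬ ∃ c ∈ I, R c d}.Finite ∧ ∀ c ∈ I, {d | R c d}.Infinite)) ↔
    ∃ κ : D → C, (∀ d, R (κ d) d) ∧ ∀ c, min (κ ⁻¹' {c}).encard N = m c ∧
      (gen → (c ∈ I ↔ (κ ⁻¹' {c}).Infinite)) := by
  classical
  constructor
  · rintro ⟨f, h1, h2, h3, h4⟩
    have hfin (c : C) : {d | f d = some c}.Finite :=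
      Set.finite_of_encard_eq_coe (h1 c)
    obtain ⟨S, hS1, hS2, hS3, hS4⟩ : ∃ S : C → Set D, (gen → ∀ c ∈ I, (S c).Infinite) ∧
        (∀ c, S c ⊆ {d | R c d} \ {d | f d ≠ none}) ∧ (∀ c, (S c).Nonempty → c ∈ I) ∧
        ∀ d c c', d ∈ S c → d ∈ S c' → c = c' := by
      by_cases hg : gen
      · have hf : {d | f d ≠ none}.Finite := by
          refine (Set.finite_iUnion hfin).subset fun d hd => ?_
          obtain ⟨c, hc⟩ := Option.ne_none_iff_exists'.1 hd
          exact Set.mem_iUnion.2 ⟨c, hc⟩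
        obtain ⟨S, hS⟩ := exists_disjoint_infinite_subsets (Set.toFinite I).countable
          fun c hc => ((h4 hg).2 c hc).sdiff hf
        exact ⟨S, fun _ => hS.1, hS.2⟩
      · exact ⟨fun _ => ∅, by simp [hg], by simp, by simp, by simp⟩
    -- The choice of colour has priorities: the colour under `f`, then the reserved set containing
    -- `d`, then an admissible colour in `I`, then an admissible colour with `m c = N`.
    have hex (d : D) : ∃ c, R c d ∧ (∀ c', f d = some c' → c' = c) ∧ (f d = none → m c = N) ∧
        (∀ c', d ∈ S c' → c' = c) ∧ (f d = none → (∃ c' ∈ I, R c' d) → c ∈ I) := by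
      rcases hfd : f d with _ | c
      · by_cases hdS : ∃ c, d ∈ S c
        · obtain ⟨c, hc⟩ := hdS
          have hcI := hS3 c ⟨d, hc⟩
          exact ⟨c, (hS2 c hc).1, by simp, fun _ => hI c hcI, fun c' hc' => hS4 d _ _ hc' hc,
            fun _ _ => hcI⟩
        · push Not at hdS
          by_cases hdI : ∃ c ∈ I, R c d
          · obtain ⟨c, hcI, hc⟩ := hdI
            exact ⟨c, hc, by simp, fun _ => hI c hcI, fun c' hc' => absurd hc' (hdS c'),
              fun _ _ => hcI⟩
          · obtain ⟨c, hcN, hc⟩ := (h3 d).resolve_left (by simp [hfd])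
            exact ⟨c, hc, by simp, fun _ => hcN, fun c' hc' => absurd hc' (hdS c'),
              fun _ h => absurd h hdI⟩
      · exact ⟨c, h2 d c hfd, fun c' h => (Option.some_inj.1 h).symm, by simp,
          fun c' hc' => absurd (by simp [hfd]) (hS2 c' hc').2, by simp⟩
    choose κ hκ using hex
    have hsub (c : C) : {d | f d = some c} ⊆ κ ⁻¹' {c} := fun d hd => ((hκ d).2.1 c hd).symm
    refine ⟨κ, fun d => (hκ d).1, fun c => ⟨?_, fun hg => ⟨fun hc => ?_, fun hinf => ?_⟩⟩⟩
    · rcases (hm c).lt_or_eq with hlt | heq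
      -- Elements outside the domain of `f` only receive colours with `m c = N`, so a class below
      -- the threshold does not grow.
      · have : κ ⁻¹' {c} = {d | f d = some c} := by
          refine (hsub c).antisymm' fun d hd => ?_
          rcases hfd : f d with _ | c'
          · have := (hκ d).2.2.1 hfd
            rw [show κ d = c from hd] at this
            omega
          · have := (hκ d).2.1 c' hfd
            rw [show κ d = c from hd] at this
            exact this ▸ hfd
        rw [this, h1, min_eq_left]
        exact_mod_cast hlt.le
      · rw [heq, min_eq_right]
        rw [← heq, ← h1]
        exact Set.encard_le_encard (hsub c)
    · exact (hS1 hg c hc).mono fun d hd => ((hκ d).2.2.2.1 c hd).symm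
    · by_contra hc
      -- An element with a colour outside `I` either has that colour under `f` or lies in the finite
      -- set admitting no colour in `I`.
      refine hinf (((hfin c).union (h4 hg).1).subset fun d hd => ?_)
      rcases hfd : f d with _ | c'
      · right
        intro hdI
        have := (hκ d).2.2.2.2 hfd hdI
        rw [show κ d = c from hd] at this
        exact hc this
      · left
        have := (hκ d).2.1 c' hfd
        rw [show κ d = c from hd] at this
        exact this ▸ hfd
  · rintro ⟨κ, hR, hκ⟩
    have hle (c : C) : (m c : ℕ∞) ≤ (κ ⁻¹' {c}).encard := (hκ c).1 ▸ min_le_left _ _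
    -- Conversely, exactly `m c` elements of each class are kept as named witnesses.
    choose t ht htc using fun c => Set.exists_subset_encard_eq (hle c)
    let f : D → Option C := fun d => if d ∈ t (κ d) then some (κ d) else none
    have hf (d : D) (c : C) : f d = some c ↔ d ∈ t c := by
      simp only [f, Option.ite_none_right_eq_some, Option.some_inj]
      constructor
      · rintro ⟨h, rfl⟩
        exact h
      · intro h
        have : κ d = c := ht c h
        exact ⟨this ▸ h, this⟩
    refine ⟨f, fun c => ?_, fun d c hd => ?_, fun d => ?_, fun hg => ⟨?_, fun c hc => ?_⟩⟩
    · simp only [hf]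
      exact htc c
    · have : κ d = c := ht c ((hf d c).1 hd)
      exact this ▸ hR d
    · by_cases hd : d ∈ t (κ d)
      · left
        rw [(hf d _).2 hd]
        simp
      · right
        refine ⟨κ d, ?_, hR d⟩
        -- If `m c < N`, the truncated size is the true size, so the kept witnesses exhaust the
        -- class and `d` would be one of them.
        by_contra hne
        have hlt := (hm (κ d)).lt_of_ne hne
        have h1 : (κ ⁻¹' {κ d}).encard = m (κ d) := by
          have h2 := (hκ (κ d)).1
          rcases min_choice (κ ⁻¹' {κ d}).encard (N : ℕ∞) with h3 | h3
          · rw [← h3, h2]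
          · rw [h3] at h2
            exact absurd (by exact_mod_cast h2.symm) hne
        have h2 := (Set.finite_of_encard_eq_coe (htc (κ d))).eq_of_subset_of_encard_le
          (ht (κ d)) (by rw [h1, htc])
        exact hd (h2 ▸ rfl : d ∈ t (κ d))
    · refine (Set.finite_iUnion fun c : {c // c ∉ I} =>
        Set.not_infinite.1 fun h => c.2 (((hκ c.1).2 hg).2 h)).subset fun d hd => ?_
      refine Set.mem_iUnion.2 ⟨⟨κ d, fun hc => hd ⟨_, hc, hR d⟩⟩, rfl⟩
    · exact (((hκ c).2 hg).1 hc).mono fun d hd => by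
        have : κ d = c := hd
        exact this ▸ hR d

theorem exists_list_count {C : Type*} [Finite C] [DecidableEq C] (m : C → ℕ) :
    ∃ l : List C, ∀ c, l.count c = m c := by
  refine ⟨(Finsupp.toMultiset (Finsupp.equivFunOnFinite.symm m)).toList, fun c => ?_⟩
  rw [← Multiset.coe_count, Multiset.coe_toList, Finsupp.count_toMultiset]
  rfl

/-- For a logic with equality there is a `B`-positive sentence that says that the valuation is a
`B`-extension of a valuation with a given signature. -/
theorem exists_signature_sentence {L : Logic} (hL : L ≠ Logic.M) (B : Set A) {N : ℕ}
    {m : Set A → ℕ} (hm : ∀ c, m c ≤ N) {I : Set (Set A)} (hI : ∀ c ∈ I, m c = N) :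
    ∃ χ : Formula A, χ.PositiveOn L B ∅ ∧ ∀ (D : Type u) (V : A → Set D) (g : ℕ → D),
      χ.Sat V g ↔ ∃ κ : D → Set A, (∀ d, TypeLe B V (κ d) d) ∧
        ∀ c, min (κ ⁻¹' {c}).encard N = m c ∧
          (L = Logic.FOEinf → (c ∈ I ↔ (κ ⁻¹' {c}).Infinite)) := by
  classical
  obtain ⟨l, hl⟩ := exists_list_count m
  let k := l.length
  let types (s : Set (Set A)) : Formula A := disj ((listOf s).map fun c => typeFormula B c k)
  -- Unnamed elements may only realise types whose count has reached `N`, as further elements do not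
  -- change a truncated count.
  let cover : Formula A := all k ((disj ((List.range k).map (equal k))).or (types {c | m c = N}))
  let infs : Formula A := (allInf k (types I)).and
    (conj ((listOf I).map fun c => exInf k (typeFormula B c k)))
  let ψ : Formula A := cover.and (if L = Logic.FOEinf then infs else top)
  have htypes (s : Set (Set A)) (X : Set ℕ) (hX : k ∈ X) : (types s).PositiveOn L B X := by
    refine .disj fun φ hφ => ?_
    obtain ⟨c, -, rfl⟩ := List.mem_map.1 hφ
    exact positiveOn_typeFormula hX
  have hψ : ψ.PositiveOn L B (Set.Iio k) := by
    refine .and (.all (.or (.disj fun φ hφ => ?_) (htypes _ _ (by simp)))) ?_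
    · obtain ⟨j, hj, rfl⟩ := List.mem_map.1 hφ
      exact .equal hL (by simp) (by simpa using (List.mem_range.1 hj).le)
    · split_ifs with h
      · refine .and (.allInf h (htypes _ _ (by simp))) (.conj fun φ hφ => ?_)
        obtain ⟨c, -, rfl⟩ := List.mem_map.1 hφ
        exact .exInf h (positiveOn_typeFormula (by simp))
      · exact .top
  refine ⟨exBlock B ψ 0 l, ?_, fun D V g => ?_⟩
  · have h := positiveOn_exBlock hL (k := 0) (cs := l) (by simpa using hψ)
    rwa [show Set.Iio (0 : ℕ) = ∅ by ext; simp] at h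
  · have hsat (s : Set (Set A)) (g : ℕ → D) (d : D) :
        (types s).Sat V (Function.update g k d) ↔ ∃ c ∈ s, TypeLe B V c d := by
      simp [types, sat_disj, mem_listOf, sat_typeFormula]
    have hcover (g : ℕ → D) : cover.Sat V g ↔
        ∀ d, d ∈ g '' Set.Iio (0 + l.length) ∨ ∃ c, m c = N ∧ TypeLe B V c d := by
      simp only [cover, Sat, hsat, sat_disj, List.mem_map, List.mem_range, exists_exists_and_eq_and,
        Function.update_self, zero_add, Set.mem_image, Set.mem_Iio, Set.mem_ofPred_eq]
      refine forall_congr' fun d => or_congr (exists_congr fun j => and_congr_right fun hj => ?_)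
        Iff.rfl
      rw [Function.update_of_ne (ne_of_lt hj), eq_comm]
    have hinfs (g : ℕ → D) : infs.Sat V g ↔ {d | ¬ ∃ c ∈ I, TypeLe B V c d}.Finite ∧
        ∀ c ∈ I, {d | TypeLe B V c d}.Infinite := by
      simp only [infs, Sat, hsat, sat_conj, List.mem_map, mem_listOf, forall_exists_index, and_imp,
        forall_apply_eq_imp_iff₂, sat_typeFormula, Function.update_self]
    let P : Set D → Prop := fun X => (∀ d, d ∈ X ∨ ∃ c, m c = N ∧ TypeLe B V c d) ∧
      (L = Logic.FOEinf → {d | ¬ ∃ c ∈ I, TypeLe B V c d}.Finite ∧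
        ∀ c ∈ I, {d | TypeLe B V c d}.Infinite)
    have hψsat (g : ℕ → D) : ψ.Sat V g ↔ P (g '' Set.Iio (0 + l.length)) := by
      simp only [ψ, P, Sat, hcover]
      refine and_congr_right fun _ => ?_
      split_ifs with h
      · simp only [hinfs, h, true_imp_iff]
      · simp [Sat, h]
    rw [sat_exBlock (P := P) hψsat, ← exists_colouring_iff hm hI]
    refine exists_congr fun f => ?_
    simp [hl, P]

end Colourings

/-! ### Sentences are invariant under equality of signatures. -/

section Transfer

variable {A : Type v} {D D' : Type u}

/-- Sentences of logics with equality cannot distinguish colourings with the same signature. -/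
theorem sat_of_signature_eq [Finite A] [Encodable A] {L : Logic} {φ : Formula A}
    (hL : φ.InLogic L) (hs : φ.IsSentence) {N : ℕ} (hN : 0 < N) (hφN : φ.VarsBelow N)
    {κ : D → Set A} {κ' : D' → Set A}
    (h : ∀ c, min (κ ⁻¹' {c}).encard N = min (κ' ⁻¹' {c}).encard N ∧
      (L = Logic.FOEinf → ((κ ⁻¹' {c}).Infinite ↔ (κ' ⁻¹' {c}).Infinite)))
    {g : ℕ → D} {g' : ℕ → D'} (hg : φ.Sat (typeVal κ) g) : φ.Sat (typeVal κ') g' := by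
  let ι := Finite.equivFin (Set A)
  obtain ⟨W, hW⟩ := exists_interpretation (A := A) ι fun a => {c | a ∈ c}
  have hpre {E : Type u} (τ : E → Set A) (c : ℕ) (hc : c < Nat.card (Set A)) :
      (fun d => (ι (τ d) : ℕ)) ⁻¹' {c} = τ ⁻¹' {ι.symm ⟨c, hc⟩} := by
    ext d
    simp [← Fin.val_inj, Equiv.eq_symm_apply]
  obtain ⟨s, -, hsig⟩ := exists_sigMatch L (Nat.card (Set A)) N fun d => (ι (κ d) : ℕ)
  have hsig' : SigMatch L (Nat.card (Set A)) N s fun d => (ι (κ' d) : ℕ) := by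
    intro c hc
    have h1 := hsig c hc
    rw [hpre κ c hc] at h1
    rw [hpre κ' c hc, ← (h _).1]
    exact ⟨h1.1, fun hLi => (h1.2 hLi).trans ((h _).2 hLi)⟩
  -- The truth of a sentence does not depend on the assignment, so it suffices to match one code
  -- with constant assignments whose values have the same colour.
  obtain ⟨d', hd'⟩ : ∃ d', κ' d' = κ (g 0) := by
    by_contra! hcon
    have h1 := (h (κ (g 0))).1
    have h2 : κ' ⁻¹' {κ (g 0)} = ∅ := Set.eq_empty_of_forall_notMem fun d hd => hcon d hd
    rw [h2, Set.encard_empty, zero_min] at h1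
    have h3 : (κ ⁻¹' {κ (g 0)}).encard ≠ 0 := by
      rw [Ne, Set.encard_eq_zero]
      exact Set.Nonempty.ne_empty ⟨g 0, rfl⟩
    have h4 : (N : ℕ∞) ≠ 0 := by exact_mod_cast hN.ne'
    simp only [min_eq_zero] at h1
    tauto
  obtain ⟨e, he, hm⟩ := exists_matches (fun d => (ι (κ d)).2) hsig hN fun _ => g 0
  have hm' : Matches (Nat.card (Set A)) N s (fun d => (ι (κ' d) : ℕ)) (fun _ => d') e :=
    fun x hx => ⟨(hm x hx).1, by simpa [hd'] using (hm x hx).2.1, fun y hy => by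
      simpa using (hm x hx).2.2 y hy⟩
  have h1 := sat_iff_mem_evalCode (V := typeVal κ) (W := W) (fun a d => hW a (κ d))
    (fun d => (ι (κ d)).2) hsig hL hφN he hm
  have h2 := sat_iff_mem_evalCode (V := typeVal κ') (W := W) (fun a d => hW a (κ' d))
    (fun d => (ι (κ' d)).2) hsig' hL hφN he hm'
  exact (hs.sat_congr _ _).1 (h2.2 (h1.1 ((hs.sat_congr _ _).1 hg)))

/-- Formulas without equality cannot distinguish colourings with the same range. -/
theorem sat_iff_of_same_colours {φ : Formula A} (hL : φ.InLogic Logic.M) {κ : D → Set A}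
    {κ' : D' → Set A} (h : ∀ d, ∃ d', κ' d' = κ d) (h' : ∀ d', ∃ d, κ' d' = κ d) :
    ∀ {g : ℕ → D} {g' : ℕ → D'}, (∀ x, κ' (g' x) = κ (g x)) →
      (φ.Sat (typeVal κ) g ↔ φ.Sat (typeVal κ') g') := by
  have upd {g : ℕ → D} {g' : ℕ → D'} (hg : ∀ x, κ' (g' x) = κ (g x)) {d : D} {d' : D'}
      (hd : κ' d' = κ d) (x : ℕ) :
      ∀ y, κ' (Function.update g' x d' y) = κ (Function.update g x d y) := by
    intro y
    by_cases hy : y = x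
    · simpa [hy] using hd
    · simpa [hy] using hg y
  induction φ with
  | top => exact fun {_ _} _ => Iff.rfl
  | bot => exact fun {_ _} _ => Iff.rfl
  | pos a x =>
    exact fun {g g'} hg => show a ∈ κ (g x) ↔ a ∈ κ' (g' x) by rw [hg x]
  | neg a x =>
    exact fun {g g'} hg => show a ∉ κ (g x) ↔ a ∉ κ' (g' x) by rw [hg x]
  | equal x y => exact (hL rfl).elim
  | nequal x y => exact (hL rfl).elim
  | or φ ψ ih₁ ih₂ => exact fun {_ _} hg => or_congr (ih₁ hL.1 hg) (ih₂ hL.2 hg)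
  | and φ ψ ih₁ ih₂ => exact fun {_ _} hg => and_congr (ih₁ hL.1 hg) (ih₂ hL.2 hg)
  | ex x φ ih =>
    intro g g' hg
    constructor
    · rintro ⟨d, hd⟩
      obtain ⟨d', hd'⟩ := h d
      exact ⟨d', (ih hL (upd hg hd' x)).1 hd⟩
    · rintro ⟨d', hd⟩
      obtain ⟨d, hd'⟩ := h' d'
      exact ⟨d, (ih hL (upd hg hd' x)).2 hd⟩
  | all x φ ih =>
    intro g g' hg
    constructor
    · intro hall d'
      obtain ⟨d, hd'⟩ := h' d'
      exact (ih hL (upd hg hd' x)).1 (hall d)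
    · intro hall d
      obtain ⟨d', hd'⟩ := h d
      exact (ih hL (upd hg hd' x)).2 (hall d')
  | exInf x φ ih => exact Logic.noConfusion hL.1
  | allInf x φ ih => exact Logic.noConfusion hL.1

theorem IsSentence.sat_of_same_colours {φ : Formula A} (hs : φ.IsSentence)
    (hL : φ.InLogic Logic.M) {κ : D → Set A} {κ' : D' → Set A} (h : ∀ d, ∃ d', κ' d' = κ d)
    (h' : ∀ d', ∃ d, κ' d' = κ d) {g : ℕ → D} {g' : ℕ → D'} (hg : φ.Sat (typeVal κ) g) :
    φ.Sat (typeVal κ') g' := by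
  obtain ⟨d', hd'⟩ := h (g 0)
  have := (sat_iff_of_same_colours hL h h' (g := fun _ => g 0) (g' := fun _ => d') fun _ => hd').1
    ((hs.sat_congr _ _).1 hg)
  exact (hs.sat_congr _ _).1 this

end Transfer

/-! ### Positive equivalents of monotone sentences. -/

section Existence

variable {A : Type v} [Finite A]

/-- The normal form is the disjunction of the signature sentences of all models of `φ`. It is finite
because counts are truncated at `N` and there are finitely many colours. -/
theorem exists_positive_of_eq [Encodable A] {L : Logic} (hLM : L ≠ Logic.M) {B : Set A}
    {φ : Formula A} (hL : φ.InLogic L) (hs : φ.IsSentence) (hmon : MonotoneIn.{u} B φ) :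
    ∃ ψ : Formula A, ψ.PositiveOn L B ∅ ∧ SatEquiv.{u} φ ψ := by
  classical
  let N := φ.godelNumber + 1
  have hφN : φ.VarsBelow N := varsBelow_of_godelNumber_lt (Nat.lt_succ_self _)
  let HasSig {D : Type u} (κ : D → Set A) (σ : (Set A → Fin (N + 1)) × Set (Set A)) : Prop :=
    ∀ c, min (κ ⁻¹' {c}).encard N = (σ.1 c : ℕ) ∧
      (L = Logic.FOEinf → (c ∈ σ.2 ↔ (κ ⁻¹' {c}).Infinite))
  let Good : Set ((Set A → Fin (N + 1)) × Set (Set A)) :=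
    {σ | (∀ c ∈ σ.2, (σ.1 c : ℕ) = N) ∧
      ∃ (D : Type u) (κ : D → Set A) (g : ℕ → D), HasSig κ σ ∧ φ.Sat (typeVal κ) g}
  have hχ (σ : (Set A → Fin (N + 1)) × Set (Set A)) : ∃ χ : Formula A, χ.PositiveOn L B ∅ ∧
      (σ ∈ Good → ∀ (D : Type u) (V : A → Set D) (g : ℕ → D), χ.Sat V g ↔
        ∃ κ : D → Set A, (∀ d, TypeLe B V (κ d) d) ∧ HasSig κ σ) := by
    by_cases hσ : σ ∈ Good
    · obtain ⟨χ, h1, h2⟩ := exists_signature_sentence.{u} hLM B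
        (fun c => Nat.lt_succ_iff.1 (σ.1 c).2) hσ.1
      exact ⟨χ, h1, fun _ => h2⟩
    -- A default that never enters the disjunction, which ranges over `Good`.
    · exact ⟨top, .top, fun h => absurd h hσ⟩
  choose χ hχpos hχsat using hχ
  refine ⟨disj ((listOf Good).map χ), .disj fun ψ hψ => ?_, fun D V g => ?_⟩
  · obtain ⟨σ, -, rfl⟩ := List.mem_map.1 hψ
    exact hχpos σ
  · rw [sat_disj]
    constructor
    · intro hg
      let κ : D → Set A := fun d => {a | d ∈ V a}
      have hle (c : Set A) : ∃ n : Fin (N + 1), min (κ ⁻¹' {c}).encard N = ((n : ℕ) : ℕ∞) := by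
        obtain ⟨n, hn⟩ := ENat.ne_top_iff_exists.1
          ((min_le_right (κ ⁻¹' {c}).encard (N : ℕ∞)).trans_lt (ENat.natCast_lt_top N)).ne
        refine ⟨⟨n, Nat.lt_succ_iff.2 ?_⟩, hn.symm⟩
        have := min_le_right (κ ⁻¹' {c}).encard (N : ℕ∞)
        rw [← hn] at this
        exact_mod_cast this
      choose m hm using hle
      have hsig : HasSig κ (m, {c | (κ ⁻¹' {c}).Infinite}) := fun c => ⟨hm c, fun _ => Iff.rfl⟩
      have hgood : (m, {c | (κ ⁻¹' {c}).Infinite}) ∈ Good := by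
        refine ⟨fun c hc => ?_, D, κ, g, hsig, hg⟩
        have := hm c
        rw [Set.Infinite.encard_eq hc, min_eq_right le_top] at this
        exact_mod_cast this.symm
      exact ⟨_, List.mem_map.2 ⟨_, mem_listOf.2 hgood, rfl⟩,
        (hχsat _ hgood D V g).2 ⟨κ, typeLe_typeOf B V, hsig⟩⟩
    · rintro ⟨_, hψ, hsat⟩
      obtain ⟨σ, hσ, rfl⟩ := List.mem_map.1 hψ
      have hgood := mem_listOf.1 hσ
      obtain ⟨κ, hκ, hsig⟩ := (hχsat σ hgood D V g).1 hsat
      obtain ⟨-, D₁, κ₁, g₁, hsig₁, hg₁⟩ := hgood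
      -- The valuation below `V` has the signature of a model of `φ`, hence satisfies `φ`;
      -- monotonicity lifts this to `V`.
      refine hmon D _ V (bExtension_typeVal hκ) g
        (sat_of_signature_eq hL hs (Nat.succ_pos _) hφN (fun c => ⟨?_, fun hLi => ?_⟩) hg₁)
      · rw [(hsig c).1, (hsig₁ c).1]
      · rw [← (hsig c).2 hLi, ← (hsig₁ c).2 hLi]

/-- The disjunct for a set `Φ` of types says that each is realised positively and that every element
realises one of them. A single element may be the only witness of several types, so a colouring with
range `Φ` need not exist on the model itself; it exists on a product with the set of types, which
formulas without equality cannot tell from the model. -/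
theorem exists_positive_of_no_eq {B : Set A} {φ : Formula A} (hL : φ.InLogic Logic.M)
    (hs : φ.IsSentence) (hmon : MonotoneIn.{u} B φ) :
    ∃ ψ : Formula A, ψ.PositiveOn Logic.M B ∅ ∧ SatEquiv.{u} φ ψ := by
  classical
  let χ (Φ : Set (Set A)) : Formula A :=
    (conj ((listOf Φ).map fun c => ex 0 (typeFormula B c 0))).and
      (all 0 (disj ((listOf Φ).map fun c => typeFormula B c 0)))
  let Good : Set (Set (Set A)) :=
    {Φ | ∃ (D : Type u) (κ : D → Set A) (g : ℕ → D), Set.range κ = Φ ∧ φ.Sat (typeVal κ) g}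
  have hχ (Φ : Set (Set A)) (D : Type u) (V : A → Set D) (g : ℕ → D) : (χ Φ).Sat V g ↔
      (∀ c ∈ Φ, ∃ d, TypeLe B V c d) ∧ ∀ d, ∃ c ∈ Φ, TypeLe B V c d := by
    simp [χ, Sat, sat_conj, sat_disj, mem_listOf, sat_typeFormula]
  refine ⟨disj ((listOf Good).map χ), .disj fun ψ hψ => ?_, fun D V g => ?_⟩
  · obtain ⟨Φ, -, rfl⟩ := List.mem_map.1 hψ
    refine .and (.conj fun θ hθ => ?_) (.all (.disj fun θ hθ => ?_))
    · obtain ⟨c, -, rfl⟩ := List.mem_map.1 hθ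
      exact .ex (positiveOn_typeFormula (by simp))
    · obtain ⟨c, -, rfl⟩ := List.mem_map.1 hθ
      exact positiveOn_typeFormula (by simp)
  · rw [sat_disj]
    constructor
    · intro hg
      refine ⟨_, List.mem_map.2 ⟨Set.range fun d => {a | d ∈ V a},
        mem_listOf.2 ⟨D, _, g, rfl, hg⟩, rfl⟩, (hχ _ D V g).2 ⟨?_, fun d => ?_⟩⟩
      · rintro _ ⟨d, rfl⟩
        exact ⟨d, typeLe_typeOf B V d⟩
      · exact ⟨_, ⟨d, rfl⟩, typeLe_typeOf B V d⟩
    · rintro ⟨_, hψ, hsat⟩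
      obtain ⟨Φ, hΦ, rfl⟩ := List.mem_map.1 hψ
      obtain ⟨D₁, κ₁, g₁, rfl, hg₁⟩ := mem_listOf.1 hΦ
      obtain ⟨h1, h2⟩ := (hχ _ D V g).1 hsat
      let ι := Finite.equivFin (Set A)
      let E : Type u := D × Fin (Nat.card (Set A))
      -- The copy of an element with index `c` receives the colour `c` whenever `c` lies in `Φ` and
      -- the element realises it; this makes all of `Φ` occur.
      have hex (p : E) : ∃ c ∈ Set.range κ₁, TypeLe B V c p.1 ∧
          (ι.symm p.2 ∈ Set.range κ₁ → TypeLe B V (ι.symm p.2) p.1 → c = ι.symm p.2) := by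
        by_cases hp : ι.symm p.2 ∈ Set.range κ₁ ∧ TypeLe B V (ι.symm p.2) p.1
        · exact ⟨_, hp.1, hp.2, fun _ _ => rfl⟩
        · obtain ⟨c, hc, hcd⟩ := h2 p.1
          exact ⟨c, hc, hcd, fun h h' => absurd ⟨h, h'⟩ hp⟩
      choose κ hκ1 hκ2 hκ3 using hex
      let V' : A → Set E := fun a => {p | p.1 ∈ V a}
      let g' : ℕ → E := fun x => (g x, ι ∅)
      have hsat : φ.Sat (typeVal κ) g' := by
        refine IsSentence.sat_of_same_colours hs hL (fun d => ?_) (fun p => ?_) hg₁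
        · obtain ⟨d', hd'⟩ := h1 (κ₁ d) ⟨d, rfl⟩
          exact ⟨(d', ι (κ₁ d)), by
            simpa using hκ3 (d', ι (κ₁ d)) (by simp) (by simpa using hd')⟩
        · obtain ⟨d, hd⟩ := hκ1 p
          exact ⟨d, hd.symm⟩
      have hsat' : φ.Sat V' g' := hmon E _ V' (bExtension_typeVal fun p => hκ2 p) g' hsat
      exact IsSentence.sat_of_same_colours (κ := fun p : E => {a | p.1 ∈ V a})
        (κ' := fun d => {a | d ∈ V a}) hs hL (fun p => ⟨p.1, rfl⟩) (fun d => ⟨(d, ι ∅), rfl⟩) hsat'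

/-- A monotone sentence is equivalent to a positive one. -/
theorem exists_positive [Encodable A] {L : Logic} {B : Set A} {φ : Formula A} (hL : φ.InLogic L)
    (hs : φ.IsSentence) (hmon : MonotoneIn.{u} B φ) :
    ∃ ψ : Formula A, ψ.Positive L B ∧ ψ.IsSentence ∧ (ψ.EmptySat ↔ φ.EmptySat) ∧
      SatEquiv.{u} φ ψ := by
  obtain ⟨ψ, hψ, heq⟩ : ∃ ψ : Formula A, ψ.PositiveOn L B ∅ ∧ SatEquiv.{u} φ ψ := by
    by_cases hLM : L = Logic.M
    · subst hLM
      exact exists_positive_of_no_eq hL hs hmon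
    · exact exists_positive_of_eq hLM hL hs hmon
  -- Equivalence so far concerns non-empty models. Adding `all 0 bot` as a disjunct, or `ex 0 top`
  -- as a conjunct, fixes the value in the empty model and changes nothing elsewhere.
  by_cases hE : φ.EmptySat
  · have h : (ψ.or (all 0 bot)).PositiveOn L B ∅ := .or hψ (.all .bot)
    refine ⟨_, h.1, h.isSentence, iff_of_true (Or.inr trivial) hE, fun D V g => ?_⟩
    rw [heq D V g]
    exact ⟨Or.inl, fun h => h.resolve_right fun h => h (g 0)⟩
  · have h : (ψ.and (ex 0 top)).PositiveOn L B ∅ := .and hψ (.ex .top)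
    refine ⟨_, h.1, h.isSentence, iff_of_false (fun h => h.2) hE, fun D V g => ?_⟩
    rw [heq D V g]
    exact ⟨fun h => ⟨h, g 0, trivial⟩, fun h => h.1⟩

end Existence

end MonadicLogic

namespace MonadicLogic

open Formula

/-! ### Effective translation -/

/-- Unbounded search for a total primitive recursive relation. -/
theorem exists_computable_choice {p : ℕ × ℕ → Prop} (hp : PrimrecPred p)
    (htot : ∀ n, ∃ k, p (n, k)) : ∃ f : ℕ → ℕ, Computable f ∧ ∀ n, p (n, f n) := by
  classical
  exact ⟨_, Computable.find (P := fun n k => p (n, k)) hp.computablePred htot,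
    fun n => Nat.find_spec (htot n)⟩

variable {A : Type v}

theorem SatEquiv.equivalent {φ ψ : Formula A} (h : SatEquiv.{u} φ ψ)
    (hE : ψ.EmptySat ↔ φ.EmptySat) : Equivalent.{u} φ ψ := by
  intro D V
  simp only [TrueIn, hE, h D V _]

theorem Equivalent.satEquiv {φ ψ : Formula A} (hφ : φ.IsSentence) (hψ : ψ.IsSentence)
    (h : Equivalent.{u} φ ψ) : SatEquiv.{u} φ ψ := by
  intro D V g
  have hne : Nonempty D := ⟨g 0⟩
  have hD : ¬ IsEmpty D := not_isEmpty_iff.2 hne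
  have := h D V
  simp only [TrueIn, hD, hne, false_and, true_and, false_or] at this
  constructor
  · exact fun hg => this.1 (fun g' => (hφ.sat_congr g g').1 hg) g
  · exact fun hg => this.2 (fun g' => (hψ.sat_congr g g').1 hg) g

/-- Gives the converse directions of both the characterisation and the translation. -/
theorem SatEquiv.monotoneIn {B : Set A} {φ ψ : Formula A} (h : SatEquiv.{u} φ ψ)
    (hψ : ψ.NegIn Bᶜ) : MonotoneIn.{u} B φ := fun D V V' hV g hg =>
  (h D V' g).2 (hψ.sat_mono hV ((h D V g).1 hg))

/-- The property of being a Gödel number of a monotone sentence is primitive recursive. -/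
theorem monotone_sentence_primrec [Finite A] [Encodable A] (L : Logic) (B : Set A) :
    PrimrecPred fun n : ℕ => ∃ φ : Formula A, φ.godelNumber = n ∧ φ.InLogic L ∧ φ.IsSentence ∧
      MonotoneIn.{u} B φ := by
  obtain ⟨p, hp, hpm⟩ := exists_primrec_monotoneIn.{u} L B
  let l : List ℕ := (listOf (Set.univ : Set A)).map Encodable.encode
  refine (((wellFormedCode_primrec L l l).and isSentence_primrec).and hp).of_eq fun n => ?_
  rw [zero_mem_wellFormedCode (A := A) (Z := Set.univ) (by simp [l, mem_listOf])
    (by simp [l, mem_listOf])]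
  constructor
  · rintro ⟨⟨⟨φ, rfl, hL, -⟩, hs⟩, hm⟩
    exact ⟨φ, rfl, hL, isSentence_iff.2 hs, (hpm φ hL).1 hm⟩
  · rintro ⟨φ, rfl, hL, hs, hm⟩
    exact ⟨⟨⟨φ, rfl, hL, negIn_univ φ⟩, isSentence_iff.1 hs⟩, (hpm φ hL).2 hm⟩

/-- There is an effective translation to positive sentences that preserves the meaning of monotone
sentences. -/
theorem exists_effective_translation [Finite A] [Encodable A] (L : Logic) (B : Set A) :
    ∃ t : Formula A → Formula A, Effective t ∧ ∀ φ, (t φ).Positive L B ∧ (t φ).IsSentence ∧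
      (φ.InLogic L → φ.IsSentence → MonotoneIn.{u} B φ → Equivalent.{u} φ (t φ)) := by
  obtain ⟨p, hp, hpe⟩ := exists_primrec_satEquiv.{u} A L
  have hmon := monotone_sentence_primrec.{u} (A := A) L B
  let l : List ℕ := (listOf (Set.univ : Set A)).map Encodable.encode
  let l' : List ℕ := (listOf Bᶜ).map Encodable.encode
  have hwf (k : ℕ) := zero_mem_wellFormedCode (A := A) (L := L) (l := l) (l' := l') (Z := Bᶜ)
    (by simp [l, mem_listOf]) (by simp [l', mem_listOf]) k
  have hpos : PrimrecPred fun k =>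
      0 ∈ wellFormedCode L l l' 0 k ∧ ∀ e < k + 1, e ∉ freeCode (k + 1) k :=
    (wellFormedCode_primrec L l l').and isSentence_primrec
  have hposiff (k : ℕ) : (0 ∈ wellFormedCode L l l' 0 k ∧ ∀ e < k + 1, e ∉ freeCode (k + 1) k) ↔
      ∃ ψ : Formula A, ψ.godelNumber = k ∧ ψ.Positive L B ∧ ψ.IsSentence := by
    rw [hwf]
    constructor
    · rintro ⟨⟨ψ, rfl, hL, hn⟩, hs⟩
      exact ⟨ψ, rfl, positive_of_negIn hL hn, isSentence_iff.2 hs⟩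
    · rintro ⟨ψ, rfl, hP, hs⟩
      exact ⟨⟨ψ, rfl, positive_iff.1 hP⟩, isSentence_iff.1 hs⟩
  -- The semantic requirement is conditional on the input coding a monotone sentence, so the search
  -- terminates on every number, and its output always codes a positive sentence.
  let q : ℕ × ℕ → Prop := fun x =>
    (∃ ψ : Formula A, ψ.godelNumber = x.2 ∧ ψ.Positive L B ∧ ψ.IsSentence) ∧
      ((∃ φ : Formula A, φ.godelNumber = x.1 ∧ φ.InLogic L ∧ φ.IsSentence ∧ MonotoneIn.{u} B φ) →
        p x ∧ (0 ∈ emptyCode 0 x.2 ↔ 0 ∈ emptyCode 0 x.1))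
  have hq : PrimrecPred q :=
    ((hpos.of_eq hposiff).comp Primrec.snd).and ((hmon.comp Primrec.fst).imp
      (hp.and ((emptyCode_primrec.comp Primrec.snd).iff (emptyCode_primrec.comp Primrec.fst))))
  have htot (n : ℕ) : ∃ k, q (n, k) := by
    by_cases h : ∃ φ : Formula A, φ.godelNumber = n ∧ φ.InLogic L ∧ φ.IsSentence ∧
        MonotoneIn.{u} B φ
    · obtain ⟨φ, rfl, hL, hs, hm⟩ := h
      obtain ⟨ψ, hP, hψs, hE, heq⟩ := exists_positive hL hs hm
      exact ⟨ψ.godelNumber, ⟨ψ, rfl, hP, hψs⟩, fun _ => ⟨(hpe φ ψ hL hP.inLogic).2 heq, by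
        simpa only [zero_mem_emptyCode] using hE⟩⟩
    · exact ⟨(bot : Formula A).godelNumber,
        ⟨bot, rfl, (PositiveOn.bot (X := ∅)).1, (PositiveOn.bot (L := L) (B := B)).isSentence⟩,
        fun h' => absurd h' h⟩
  obtain ⟨f, hf, hfq⟩ := exists_computable_choice hq htot
  choose t ht htP hts using fun φ : Formula A => (hfq φ.godelNumber).1
  refine ⟨t, ⟨f, hf, fun φ => (ht φ).symm⟩, fun φ => ⟨htP φ, hts φ, fun hL hs hm => ?_⟩⟩
  obtain ⟨h1, h2⟩ := (hfq φ.godelNumber).2 ⟨φ, rfl, hL, hs, hm⟩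
  have hcode : (t φ).godelNumber = f φ.godelNumber := ht φ
  simp only [← hcode, zero_mem_emptyCode] at h1 h2
  exact ((hpe φ (t φ) hL (htP φ).inLogic).1 h1).equivalent h2

end MonadicLogic

/-! ### The characterisation theorem. -/

theorem theoremt {A : Type v} [Finite A] [Encodable A]
    (L : MonadicLogic.Logic) (B : Set A) :
    (∀ φ : MonadicLogic.Formula A, φ.InLogic L → φ.IsSentence →
      (MonadicLogic.Formula.MonotoneIn.{u} B φ ↔
        ∃ ψ : MonadicLogic.Formula A, ψ.Positive L B ∧ ψ.IsSentence ∧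
          MonadicLogic.Formula.Equivalent.{u} φ ψ)) ∧
    (∃ t : MonadicLogic.Formula A → MonadicLogic.Formula A,
      MonadicLogic.Effective t ∧
      ∀ φ : MonadicLogic.Formula A, φ.InLogic L → φ.IsSentence →
        (t φ).Positive L B ∧ (t φ).IsSentence ∧
        (MonadicLogic.Formula.MonotoneIn.{u} B φ ↔
          MonadicLogic.Formula.Equivalent.{u} φ (t φ))) ∧
    MonadicLogic.DecidableProperty (fun φ : MonadicLogic.Formula A =>
      φ.InLogic L ∧ φ.IsSentence ∧ MonadicLogic.Formula.MonotoneIn.{u} B φ) := by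
  refine ⟨fun φ hL hs => ⟨fun hm => ?_, ?_⟩, ?_, ?_⟩
  · obtain ⟨ψ, hP, hψs, hE, heq⟩ := MonadicLogic.exists_positive hL hs hm
    exact ⟨ψ, hP, hψs, heq.equivalent hE⟩
  · rintro ⟨ψ, hP, hψs, heq⟩
    exact (MonadicLogic.Equivalent.satEquiv hs hψs heq).monotoneIn hP.negIn
  · obtain ⟨t, ht, hspec⟩ := MonadicLogic.exists_effective_translation.{u} (A := A) L B
    refine ⟨t, ht, fun φ hL hs => ⟨(hspec φ).1, (hspec φ).2.1, (hspec φ).2.2 hL hs, fun heq => ?_⟩⟩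
    exact (MonadicLogic.Equivalent.satEquiv hs (hspec φ).2.1 heq).monotoneIn (hspec φ).1.negIn
  · exact (MonadicLogic.monotone_sentence_primrec L B).computablePred
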